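/- Let $(\Omega,\mathcal F,(\mathcal F_t)_{t\ge 0},\mathcal Q)$ be a filtered probability space carrying a standard two-dimensional $(\mathcal F_t)$-Brownian motion $B$ with independent components. Let $T\ge 0$, $r\in\mathbb R$ and $q=(q_1,q_2)\in\mathbb R^2$. Let $(\Sigma_t^{1/2})_{0\le t\le T}$ be a progressively measurable process of symmetric real $2\times2$ matrices which is independent of $B$ and satisfies $\int_0^T\|\Sigma_t^{1/2}\|^2dt<\infty$ almost surely, and put $\Sigma_t=\Sigma_t^{1/2}\Sigma_t^{1/2}$. Let the price process $S=(S^{(1)},S^{(2)})$ be given by $S^{(j)}_t=S^{(j)}_0\exp(Y^{(j)}_t)$, $S^{(j)}_0>0$, $j=1,2$, where $Y$ is adapted and satisfies on $[0,T]$ $$dY_t=\bigl(r-q-\tfrac12\operatorname{diag}(\Sigma_t)\bigr)dt+\Sigma_t^{1/2}\,dB_t ,$$ with an Itô stochastic integral. Here $r$ also denotes the vector $(r,r)$, and $\operatorname{diag}(A)$ is the vector of diagonal entries of a matrix $A$. Put $\Sigma^+_T=\int_0^T\Sigma_t\,dt$ (entrywise). Then: 1. Almost surely $\Sigma_T^+$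 is finite and positive semidefinite, and conditionally on the $\sigma$-algebra generated by $(\Sigma_t)_{0\le t\le T}$ the random vector $Y_T$ has the (possibly degenerate) bivariate normal distribution $$N\bigl((r-q)T-\tfrac12\operatorname{diag}(\Sigma^+_T),\ \Sigma^+_T\bigr).$$ 2. If $\Sigma_t=\Sigma$ does not depend on $t\in[0,T]$, then $\Sigma_T^+=\Sigma\,T$. 3. For every $u=(u_1,u_2)\in\mathbb R^2$ the characteristic function $\varphi_{Y_T}(u)=E_{\mathcal Q}[e^{iu\cdot Y_T}]$ is $$\varphi_{Y_T}(u)=e^{iu\cdot(r-q)T}\,\varphi_{\Sigma^+_T}\bigl(-\tfrac12\theta(u)\bigr),\qquad \theta(u)=\begin{pmatrix}u_1(1-iu_1)&-iu_1u_2\\-iu_1u_2&u_2(1-iu_2)\end{pmatrix},$$ where $\varphi_{\Sigma^+_T}(\theta)=E_{\mathcal Q}[\exp(i\operatorname{tr}(\theta\,\Sigma^+_T))]$ for complex $2\times 2$ matrices $\theta$ for which the expectation exists; at $-\frac12\theta(u)$ the expectation does exist. -/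

import Mathlib

open MeasureTheory ProbabilityTheory Filter
open scoped NNReal ENNReal Topology Matrix

noncomputable section

namespace StochCov

/-- The plane `ℝ²` in which prices, log-prices and the Brownian motion live. -/
abbrev Plane : Type := EuclideanSpace ℝ (Fin 2)

/-- Real `2 × 2` matrices. -/
abbrev Mat : Type := Matrix (Fin 2) (Fin 2) ℝ

variable {Ω : Type*} {mΩ : MeasurableSpace Ω}

/-- `B` is a standard two-dimensional Brownian motion with independent components on the
filtered probability space `(Ω, ℱ, Q)`: every component is a real Brownian motion, the two
component processes are independent, `B` is adapted to `ℱ`, and the increments of `B` after time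
`s` are independent of `ℱ s`. -/
structure IsPlanarBrownian (ℱ : Filtration ℝ≥0 mΩ) (Q : Measure Ω) (B : ℝ≥0 → Ω → Plane) :
    Prop where
  component : ∀ i, IsBrownianReal (fun t ω => B t ω i) Q
  indep_components : iIndepFun (fun (i : Fin 2) (ω : Ω) (t : ℝ≥0) => B t ω i) Q
  adapted : ∀ t, Measurable[ℱ t] (B t)
  indep_increments : ∀ s t, s ≤ t →
    Indep (MeasurableSpace.comap (fun ω => B t ω - B s ω) inferInstance) (ℱ s) Q

/-- A matrix-valued elementary (simple predictable) process: a finite sum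
`∑ₖ ξₖ 1_{(aₖ, bₖ]}` with `aₖ ≤ bₖ` and `ξₖ` bounded and `ℱ_{aₖ}`-measurable. -/
structure ElementaryProcess (ℱ : Filtration ℝ≥0 mΩ) where
  /-- number of terms -/
  n : ℕ
  /-- left end points of the intervals -/
  left : Fin n → ℝ≥0
  /-- right end points of the intervals -/
  right : Fin n → ℝ≥0
  /-- random coefficients -/
  coeff : Fin n → Ω → Mat
  left_le_right : ∀ k, left k ≤ right k
  measurable_coeff : ∀ k i j, Measurable[ℱ (left k)] (fun ω => coeff k ω i j)
  bounded_coeff : ∃ C : ℝ, ∀ k ω i j, |coeff k ω i j| ≤ C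

namespace ElementaryProcess

variable {ℱ : Filtration ℝ≥0 mΩ}

/-- The value `∑ₖ ξₖ 1_{(aₖ, bₖ]}(t)` of an elementary process. -/
def value (G : ElementaryProcess ℱ) (t : ℝ≥0) (ω : Ω) : Mat :=
  ∑ k, (Set.Ioc (G.left k) (G.right k)).indicator (fun _ => G.coeff k ω) t

/-- The stochastic integral `∫₀ᵗ G dB = ∑ₖ ξₖ (B_{bₖ ∧ t} - B_{aₖ ∧ t})` of an elementary
process. -/
def integral (G : ElementaryProcess ℱ) (B : ℝ≥0 → Ω → Plane) (t : ℝ≥0) (ω : Ω) : Plane :=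
  ∑ k, WithLp.toLp 2
    (G.coeff k ω *ᵥ (fun i => B (min (G.right k) t) ω i - B (min (G.left k) t) ω i))

end ElementaryProcess

/-- `M` is (a version of) the Itô integral process `M_t = ∫₀ᵗ H dB`, `0 ≤ t ≤ T`. The integrand
is progressively measurable, its square is almost surely integrable on `[0, T]`, and `M` is the
limit in probability of the integrals of elementary processes that approximate `H`, where
`G` is close to `H` when `∫₀ᵀ ‖G_s - H_s‖² ds` is small in probability. -/
structure IsItoIntegral (ℱ : Filtration ℝ≥0 mΩ) (Q : Measure Ω) (B : ℝ≥0 → Ω → Plane)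
    (H : ℝ≥0 → Ω → Mat) (T : ℝ≥0) (M : ℝ≥0 → Ω → Plane) : Prop where
  progressive : ∀ i j, IsStronglyProgressive ℱ (fun t ω => H t ω i j)
  sq_integrable : ∀ᵐ ω ∂Q, ∀ i j,
    IntervalIntegrable (fun s : ℝ => (H s.toNNReal ω i j) ^ 2) volume 0 T
  exists_approx : ∃ G : ℕ → ElementaryProcess ℱ,
    TendstoInMeasure Q
      (fun n ω => ∫ s in (0 : ℝ)..T,
        ∑ i, ∑ j, ((G n).value s.toNNReal ω i j - H s.toNNReal ω i j) ^ 2)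
      atTop (fun _ => 0) ∧
    ∀ t ≤ T, TendstoInMeasure Q (fun n => (G n).integral B t) atTop (M t)

/-- The price model on `[0, T]` under the pricing measure `Q`: `S` is the pair of asset prices,
`Y` the log-prices, `V` the covariance process `Σ`, `H` its symmetric square root `Σ^{1/2}`, `r`
the interest rate and `q` the dividend rates. The dynamics
`dY = (r - q - ½ diag Σ) dt + Σ^{1/2} dB` is read as the integrated equation. -/
structure IsPriceModel (ℱ : Filtration ℝ≥0 mΩ) (Q : Measure Ω) (r : ℝ) (q : Plane) (T : ℝ≥0)
    (S Y B : ℝ≥0 → Ω → Plane) (V H : ℝ≥0 → Ω → Mat) : Prop where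
  brownian : IsPlanarBrownian ℱ Q B
  adapted : ∀ t ≤ T, Measurable[ℱ t] (Y t)
  initial_pos : ∀ᵐ ω ∂Q, ∀ j, 0 < S 0 ω j
  price : ∀ t ≤ T, ∀ᵐ ω ∂Q, ∀ j, S t ω j = S 0 ω j * Real.exp (Y t ω j)
  sqrt_symm : ∀ t ≤ T, ∀ ω, (H t ω).IsSymm
  sqrt_mul_sqrt : ∀ t ≤ T, ∀ ω, H t ω * H t ω = V t ω
  /-- the volatility process is independent of the driving Brownian motion -/
  indep : IndepFun (fun ω (t : Set.Iic T) (i j : Fin 2) => H t ω i j)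
    (fun ω (t : Set.Iic T) => B t ω) Q
  dynamics : ∃ M : ℝ≥0 → Ω → Plane, IsItoIntegral ℱ Q B H T M ∧
    ∀ t ≤ T, ∀ᵐ ω ∂Q, ∀ j, Y t ω j = Y 0 ω j
      + (∫ s in (0 : ℝ)..t, (r - q j - 1 / 2 * V s.toNNReal ω j j)) + M t ω j

/-- The path `(Σ_t)_{0 ≤ t ≤ T}`; with the product σ-algebra on its codomain it generates
the σ-algebra `ℱ^{Σ_T}` of the covariance process up to time `T`. -/
def covPath (V : ℝ≥0 → Ω → Mat) (T : ℝ≥0) (ω : Ω) : Set.Iic T → Fin 2 → Fin 2 → ℝ :=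
  fun t i j => V t ω i j

/-- The integrated covariance `Σ⁺_T = ∫₀ᵀ Σ_t dt`, entry by entry. -/
def intCov (V : ℝ≥0 → Ω → Mat) (T : ℝ≥0) (ω : Ω) : Mat :=
  Matrix.of fun j k => ∫ t in (0 : ℝ)..T, V t.toNNReal ω j k

/-- `exp(i tr(θ X))` for a real matrix `X` and a complex matrix `θ`. -/
def expTrace (θ : Matrix (Fin 2) (Fin 2) ℂ) (X : Mat) : ℂ :=
  Complex.exp (Complex.I * (θ * X.map (fun x : ℝ => (x : ℂ))).trace)

/-- The characteristic function `φ_X(θ) = E[exp(i tr(θ X))]` of a random matrix `X`, at a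
complex matrix argument. -/
def matCharFun (Q : Measure Ω) (X : Ω → Mat) (θ : Matrix (Fin 2) (Fin 2) ℂ) : ℂ :=
  ∫ ω, expTrace θ (X ω) ∂Q

/-- The matrix `θ(u)`. -/
def thetaMat (u : Plane) : Matrix (Fin 2) (Fin 2) ℂ :=
  !![(u 0 : ℂ) * (1 - Complex.I * u 0), -Complex.I * u 0 * u 1;
     -Complex.I * u 0 * u 1, (u 1 : ℂ) * (1 - Complex.I * u 1)]

end StochCov

end

/-! Given the covariance path, the volatility behaves as a deterministic function, because the root
process is independent of the Brownian motion. The Itô integral is then a Wiener integral: Gaussian,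
centred, with covariance `∫ H Hᵀ = ∫ Σ`. The drift is a function of the same path, so `Y_T` is
conditionally normal, and averaging the conditional characteristic function gives the unconditional
one.

The difficulty is that the Itô integral is only a limit in probability along some elementary
approximations `G n`, whose coefficients may depend on `B`, so freezing the path is not possible in
them. The proof replaces them by approximations `K n` that are functions of the path of `H` alone
(`exists_seq_elementary`): truncate, then sample at left points on a suitably shifted grid
(`exists_shifted_grid`). Lenglart's inequality (`measure_le_abs_transform`) shows that the integrals
of `K n` and `G n` have the same limit in probability (`tendstoInMeasure_integral_sub`).

For `K n` the joint law of `H` and `B` is a product, and Fubini reduces the claim to Gaussian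
increments with constant coefficients (`integral_mul_cexp_elementary`). Dominated convergence
carries the identity, with any bounded weight depending on the path of `H`, to the Itô integral
(`IsItoIntegral.integral_mul_cexp`). Weights depending on `Σ` only yield the conditional
characteristic function. For this, `Σ⁺_T` has to be measurable, up to null sets, for the σ-algebra
of the path of `Σ`, which `aestronglyMeasurable_integral` provides. Characteristic functions on a
countable dense set then determine the conditional law. -/

namespace StochCov

/-! ### Continuity of translation and the choice of a grid shift -/

section Translation

theorem setLIntegral_Ioc_add_left (F : ℝ → ℝ≥0∞) (c a b : ℝ) :
    ∫⁻ t in Set.Ioc (c + a) (c + b), F t = ∫⁻ h in Set.Ioc a b, F (c + h) := by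
  rw [← (measurePreserving_add_left volume c).setLIntegral_comp_preimage_emb
    (measurableEmbedding_addLeft c), Set.preimage_const_add_Ioc]
  simp

variable {E : Type*} [NormedAddCommGroup E]

/-- Translation is continuous in `L¹(ℝ)`. -/
theorem tendsto_lintegral_enorm_translate_sub {f : ℝ → E} (hf : Integrable f) :
    Tendsto (fun h : ℝ => ∫⁻ t, ‖f (t + h) - f t‖ₑ) (𝓝 0) (𝓝 0) := by
  have hf1 : MemLp f 1 volume := memLp_one_iff_integrable.2 hf
  let g : ℝ → C(ℝ, ℝ) := fun h => ⟨fun t => t + h, by fun_prop⟩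
  have hg : Continuous g := ContinuousMap.continuous_of_continuous_uncurry _ (by
    simp only [g, Function.uncurry_def, ContinuousMap.coe_mk]; fun_prop)
  have hgm : ∀ h, MeasurePreserving (g h) volume volume := fun h =>
    measurePreserving_add_right volume h
  -- Composition with a continuously varying family of measure-preserving maps is continuous in `Lᵖ`
  -- for finite `p`; the translations `g h` form such a family.
  have hc := (continuous_const (y := hf1.toLp f)).compMeasurePreservingLp hg hgm ENNReal.one_ne_top
  have h0 := hc.tendsto 0
  rw [tendsto_iff_edist_tendsto_0] at h0
  refine h0.congr fun h => ?_
  rw [Lp.toLp_compMeasurePreserving, Lp.toLp_compMeasurePreserving, Lp.edist_toLp_toLp,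
    eLpNorm_one_eq_lintegral_enorm]
  simp [g]

variable {Ω : Type*} {mΩ : MeasurableSpace Ω} {Q : Measure Ω}

/-- Translation in time is continuous in `L¹(ℝ × Ω)`. -/
theorem tendsto_lintegral_enorm_translate_sub_prod [SFinite Q] {f : ℝ → Ω → E}
    (hm : StronglyMeasurable (Function.uncurry f))
    (hf : Integrable (Function.uncurry f) (volume.prod Q)) :
    Tendsto (fun h : ℝ => ∫⁻ t, ∫⁻ ω, ‖f (t + h) ω - f t ω‖ₑ ∂Q) (𝓝 0) (𝓝 0) := by
  have hmeas : ∀ h : ℝ, Measurable fun p : ℝ × Ω => ‖f (p.1 + h) p.2 - f p.1 p.2‖ₑ := fun h =>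
    ((hm.comp_measurable (g := fun p : ℝ × Ω => (p.1 + h, p.2)) (by fun_prop)).sub hm).enorm
  have hfin : ∫⁻ ω, ∫⁻ t, ‖f t ω‖ₑ ∂volume ∂Q ≠ ∞ := by
    have := hf.2
    rw [HasFiniteIntegral, lintegral_prod_symm' _ hm.enorm] at this
    exact this.ne
  have hint : ∀ᵐ ω ∂Q, Integrable (fun t => f t ω) := hf.prod_left_ae
  have hswap : ∀ h : ℝ, ∫⁻ t, ∫⁻ ω, ‖f (t + h) ω - f t ω‖ₑ ∂Q
      = ∫⁻ ω, ∫⁻ t, ‖f (t + h) ω - f t ω‖ₑ ∂volume ∂Q := fun h =>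
    lintegral_lintegral_swap (hmeas h).aemeasurable
  simp_rw [hswap]
  -- Dominated convergence in `ω`: almost every path obeys the deterministic statement, and its
  -- translation error is at most twice its `L¹` norm.
  have key := tendsto_lintegral_filter_of_dominated_convergence (μ := Q) (l := 𝓝 (0 : ℝ))
    (F := fun h ω => ∫⁻ t, ‖f (t + h) ω - f t ω‖ₑ) (f := fun _ => 0)
    (fun ω => 2 * ∫⁻ t, ‖f t ω‖ₑ)
    (.of_forall fun h => (hmeas h).lintegral_prod_left') ?_ ?_ ?_
  · simpa using key
  · refine .of_forall fun h => ?_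
    filter_upwards [hint] with ω hω
    calc ∫⁻ t, ‖f (t + h) ω - f t ω‖ₑ ≤ ∫⁻ t, (‖f (t + h) ω‖ₑ + ‖f t ω‖ₑ) :=
          lintegral_mono fun t => enorm_sub_le
      _ = (∫⁻ t, ‖f (t + h) ω‖ₑ) + ∫⁻ t, ‖f t ω‖ₑ := lintegral_add_right' _ hω.1.enorm
      _ = 2 * ∫⁻ t, ‖f t ω‖ₑ := by
          rw [lintegral_add_right_eq_self (fun t => ‖f t ω‖ₑ) h, two_mul]
  · rw [lintegral_const_mul' _ _ (by simp)]
    exact ENNReal.mul_ne_top (by simp) hfin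
  · filter_upwards [hint] with ω hω using tendsto_lintegral_enorm_translate_sub hω

/-- A process that is integrable in time and randomness is approximated in `L¹` by its
left-point discretisation along a suitably shifted uniform grid. -/
theorem exists_shifted_grid [SFinite Q] {f : ℝ → Ω → E}
    (hm : StronglyMeasurable (Function.uncurry f))
    (hf : Integrable (Function.uncurry f) (volume.prod Q))
    {T : ℝ} (hT : 0 < T) {η : ℝ} (hη : 0 < η) {ε : ℝ≥0∞} (hε : ε ≠ 0) :
    ∃ n : ℕ, 0 < n ∧ ∃ δ : ℝ, 0 < δ ∧ n * δ = T ∧ δ ≤ η ∧ ∃ s ∈ Set.Ioc 0 δ,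
      ∑ k ∈ Finset.range n, ∫⁻ t in Set.Ioc (s + k * δ) (s + (k + 1) * δ),
        ∫⁻ ω, ‖f t ω - f (s + k * δ) ω‖ₑ ∂Q ≤ ε := by
  set G : ℝ → ℝ → ℝ≥0∞ := fun s h => ∫⁻ ω, ‖f (s + h) ω - f s ω‖ₑ ∂Q with hG
  have hGm : Measurable (Function.uncurry G) := by
    have : Measurable fun p : (ℝ × ℝ) × Ω => ‖f (p.1.1 + p.1.2) p.2 - f p.1.1 p.2‖ₑ :=
      ((hm.comp_measurable (g := fun p : (ℝ × ℝ) × Ω => (p.1.1 + p.1.2, p.2)) (by fun_prop)).sub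
        (hm.comp_measurable (g := fun p : (ℝ × ℝ) × Ω => (p.1.1, p.2)) (by fun_prop))).enorm
    exact this.lintegral_prod_right'
  have hsmall : ∀ᶠ h in 𝓝 (0 : ℝ), ∫⁻ t, G t h ≤ ε :=
    (tendsto_lintegral_enorm_translate_sub_prod hm hf).eventually_le_const
      (pos_iff_ne_zero.2 hε)
  obtain ⟨ρ, hρ, hball⟩ := Metric.eventually_nhds_iff.1 hsmall
  obtain ⟨n, hn⟩ := exists_nat_gt (T / min η (ρ / 2))
  have hmin : 0 < min η (ρ / 2) := lt_min hη (by linarith)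
  have hn0 : (0 : ℝ) < n := (by positivity : 0 < T / min η (ρ / 2)).trans hn
  set δ : ℝ := T / n with hδ
  have hδ0 : 0 < δ := by positivity
  have hδle : δ ≤ min η (ρ / 2) := by
    rw [div_lt_iff₀ hmin] at hn
    rw [hδ, div_le_iff₀ hn0]; linarith
  refine ⟨n, by exact_mod_cast hn0, δ, hδ0, by rw [hδ]; field_simp, hδle.trans (min_le_left _ _), ?_⟩
  have htrans : ∀ (s : ℝ) (k : ℕ), ∫⁻ t in Set.Ioc (s + k * δ) (s + (k + 1) * δ),
        ∫⁻ ω, ‖f t ω - f (s + k * δ) ω‖ₑ ∂Q = ∫⁻ h in Set.Ioc 0 δ, G (s + k * δ) h := by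
    intro s k
    have := setLIntegral_Ioc_add_left (fun t => ∫⁻ ω, ‖f t ω - f (s + k * δ) ω‖ₑ ∂Q) (s + k * δ) 0 δ
    rwa [add_zero, show s + k * δ + δ = s + (k + 1) * δ by ring] at this
  simp_rw [htrans]
  have hmk : ∀ k : ℕ, Measurable fun p : ℝ × ℝ => G (p.1 + k * δ) p.2 := fun k =>
    hGm.comp (g := Function.uncurry G) (f := fun p : ℝ × ℝ => (p.1 + k * δ, p.2)) (by fun_prop)
  have hmeasS : Measurable fun s : ℝ =>
      ∑ k ∈ Finset.range n, ∫⁻ h in Set.Ioc 0 δ, G (s + k * δ) h :=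
    Finset.measurable_sum _ fun k _ => (hmk k).lintegral_prod_right'
  have hvol : volume (Set.Ioc (0 : ℝ) δ) = ENNReal.ofReal δ := by simp
  have hδne : ENNReal.ofReal δ ≠ 0 := by simpa using hδ0
  -- A fixed grid may sample `f` at bad times, since `L¹` closeness says nothing about single times.
  -- Averaging the error over all shifts in `(0, δ]` avoids this: some shift does no worse than the
  -- average.
  obtain ⟨s, hs, hle⟩ := exists_le_setLAverage (μ := volume) (s := Set.Ioc (0 : ℝ) δ)
    (by rwa [hvol]) (by simp) hmeasS.aemeasurable
  refine ⟨s, hs, hle.trans ?_⟩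
  rw [setLAverage_eq, hvol, ENNReal.div_le_iff hδne (by simp)]
  calc ∫⁻ s in Set.Ioc 0 δ, ∑ k ∈ Finset.range n, ∫⁻ h in Set.Ioc 0 δ, G (s + k * δ) h
      = ∑ k ∈ Finset.range n, ∫⁻ h in Set.Ioc 0 δ, ∫⁻ s in Set.Ioc 0 δ, G (s + k * δ) h := by
        rw [lintegral_finsetSum _ fun k _ => (hmk k).lintegral_prod_right']
        exact Finset.sum_congr rfl fun k _ => lintegral_lintegral_swap (hmk k).aemeasurable
    _ = ∫⁻ h in Set.Ioc 0 δ, ∑ k ∈ Finset.range n, ∫⁻ s in Set.Ioc 0 δ, G (s + k * δ) h :=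
        (lintegral_finsetSum _ fun k _ => (hmk k).lintegral_prod_left').symm
    _ ≤ ∫⁻ h in Set.Ioc 0 δ, ε := by
        refine setLIntegral_mono measurable_const fun h hh => ?_
        -- For fixed `h`, the sampling points `s + kδ` sweep disjoint intervals as `s` and `k` vary,
        -- so the whole sum is at most the integral of `G · h` over the line, which is at most `ε`
        -- since `h ≤ δ < ρ`.
        have hshift : ∀ k : ℕ, ∫⁻ s in Set.Ioc 0 δ, G (s + k * δ) h
            = ∫⁻ s in Set.Ioc (k * δ) ((k + 1 : ℕ) * δ), G s h := by
          intro k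
          have := setLIntegral_Ioc_add_left (fun t => G t h) (k * δ) 0 δ
          rw [add_zero, show k * δ + δ = (k + 1 : ℕ) * δ by push_cast; ring] at this
          rw [this]
          simp_rw [add_comm]
        have hmono : Monotone fun k : ℕ => (k : ℝ) * δ := fun a b hab => by
          have : (a : ℝ) ≤ b := by exact_mod_cast hab
          dsimp only; gcongr
        simp_rw [hshift]
        rw [← lintegral_biUnion_finset (s := Finset.range n)
          (t := fun k : ℕ => Set.Ioc (k * δ) ((k + 1 : ℕ) * δ))
          (fun a _ b _ hab => hmono.pairwise_disjoint_on_Ioc_succ hab)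
          (fun _ _ => measurableSet_Ioc)]
        refine (setLIntegral_le_lintegral _ _).trans (hball ?_)
        rw [Real.dist_eq, sub_zero, abs_of_pos hh.1]
        have := hδle.trans (min_le_right _ _)
        linarith [hh.2]
    _ = ε * ENNReal.ofReal δ := by simp

end Translation

end StochCov

namespace StochCov

/-! ### Martingale transforms of Brownian motion -/

section MartingaleTransform

variable {Ω : Type*} {mΩ : MeasurableSpace Ω} {Q : Measure Ω} {ℱ : Filtration ℝ≥0 mΩ}
  {b : ℝ≥0 → Ω → ℝ} {τ : ℕ → ℝ≥0} {ξ : ℕ → Ω → ℝ} {C : ℝ}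

/-- `b` is a real Brownian motion adapted to `ℱ` whose increments are independent of the past. -/
structure IsFilteredBrownian (ℱ : Filtration ℝ≥0 mΩ) (Q : Measure Ω) (b : ℝ≥0 → Ω → ℝ) :
    Prop where
  brownian : IsPreBrownianReal b Q
  adapted : ∀ t, Measurable[ℱ t] (b t)
  indep : ∀ s t, s ≤ t → Indep (MeasurableSpace.comap (fun ω => b t ω - b s ω) inferInstance)
    (ℱ s) Q

namespace IsFilteredBrownian

theorem measurable (hb : IsFilteredBrownian ℱ Q b) (t : ℝ≥0) : Measurable (b t) :=
  (hb.adapted t).mono (ℱ.le t) le_rfl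

theorem hasLaw_sub (hb : IsFilteredBrownian ℱ Q b) {s t : ℝ≥0} (hst : s ≤ t) :
    HasLaw (fun ω => b t ω - b s ω) (gaussianReal 0 (t - s)) Q := by
  have := hb.brownian.hasLaw_sub t s
  have e : nndist t.1 s.1 = t - s := by
    refine NNReal.eq ?_
    have : (s : ℝ) ≤ t := by exact_mod_cast hst
    rw [coe_nndist, Real.dist_eq, NNReal.coe_sub hst]
    exact abs_of_nonneg (by simpa using this)
  rw [e] at this
  exact this

theorem indepFun (hb : IsFilteredBrownian ℱ Q b) {s t : ℝ≥0} (hst : s ≤ t) {Z : Ω → ℝ}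
    (hZ : Measurable[ℱ s] Z) : IndepFun Z (fun ω => b t ω - b s ω) Q := by
  rw [IndepFun_iff_Indep]
  exact indep_of_indep_of_le_left (hb.indep s t hst).symm hZ.comap_le

theorem memLp_sub (hb : IsFilteredBrownian ℱ Q b) {s t : ℝ≥0} (hst : s ≤ t) :
    MemLp (fun ω => b t ω - b s ω) 2 Q :=
  (hb.hasLaw_sub hst).hasGaussianLaw.memLp_two

theorem integral_sub (hb : IsFilteredBrownian ℱ Q b) {s t : ℝ≥0} (hst : s ≤ t) :
    ∫ ω, (b t ω - b s ω) ∂Q = 0 := by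
  rw [(hb.hasLaw_sub hst).integral_eq, integral_id_gaussianReal]

theorem integral_sub_sq (hb : IsFilteredBrownian ℱ Q b) {s t : ℝ≥0} (hst : s ≤ t) :
    ∫ ω, (b t ω - b s ω) ^ 2 ∂Q = (t : ℝ) - s := by
  have h := (hb.hasLaw_sub hst).variance_eq
  rw [variance_id_gaussianReal, variance_of_integral_eq_zero
    (hb.hasLaw_sub hst).aemeasurable (hb.integral_sub hst)] at h
  rw [h, NNReal.coe_sub hst]

end IsFilteredBrownian

/-- The martingale transform `∑_{k < n} ξₖ (b_{τₖ₊₁} - b_{τₖ})`. -/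
def transform (b : ℝ≥0 → Ω → ℝ) (τ : ℕ → ℝ≥0) (ξ : ℕ → Ω → ℝ) (n : ℕ) (ω : Ω) : ℝ :=
  ∑ k ∈ Finset.range n, ξ k ω * (b (τ (k + 1)) ω - b (τ k) ω)

/-- The bracket `∑_{k < n} ξₖ² (τₖ₊₁ - τₖ)`. -/
def bracket (τ : ℕ → ℝ≥0) (ξ : ℕ → Ω → ℝ) (n : ℕ) (ω : Ω) : ℝ :=
  ∑ k ∈ Finset.range n, ξ k ω ^ 2 * ((τ (k + 1) : ℝ) - τ k)

theorem measurable_transform (hb : IsFilteredBrownian ℱ Q b) (hτ : Monotone τ)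
    (hξ : ∀ k, Measurable[ℱ (τ k)] (ξ k)) (n : ℕ) :
    Measurable[ℱ (τ n)] (transform b τ ξ n) := by
  unfold transform
  refine Finset.measurable_sum _ fun k hk => ?_
  have hk' : k + 1 ≤ n := Finset.mem_range.1 hk
  exact ((hξ k).mono (ℱ.mono (hτ (by omega))) le_rfl).mul
    (((hb.adapted _).mono (ℱ.mono (hτ hk')) le_rfl).sub
      ((hb.adapted _).mono (ℱ.mono (hτ (by omega))) le_rfl))

/-- The last summand involves only `ξ n` and deterministic times, so the bracket up to `n + 1` is
known already at `τ n`. This predictability is what makes the truncation in Lenglart's inequality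
admissible. -/
theorem measurable_bracket (hτ : Monotone τ) (hξ : ∀ k, Measurable[ℱ (τ k)] (ξ k)) (n : ℕ) :
    Measurable[ℱ (τ n)] (bracket τ ξ (n + 1)) := by
  unfold bracket
  refine Finset.measurable_sum _ fun k hk => ?_
  have hk' : k ≤ n := Nat.lt_succ_iff.1 (Finset.mem_range.1 hk)
  exact (((hξ k).mono (ℱ.mono (hτ hk')) le_rfl).pow_const 2).mul_const _

theorem memLp_transform [IsFiniteMeasure Q] (hb : IsFilteredBrownian ℱ Q b) (hτ : Monotone τ)
    (hξ : ∀ k, Measurable[ℱ (τ k)] (ξ k)) (hC : ∀ k ω, |ξ k ω| ≤ C) (n : ℕ) :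
    MemLp (transform b τ ξ n) 2 Q := by
  unfold transform
  refine memLp_finsetSum _ fun k _ => ?_
  refine MemLp.mul (p := ∞) (q := 2) (hb.memLp_sub (hτ k.le_succ)) ?_
  exact memLp_top_of_bound ((hξ k).mono (ℱ.le _) le_rfl).aestronglyMeasurable C
    (.of_forall fun ω => hC k ω)

/-- The Itô isometry for martingale transforms. -/
theorem integral_transform_sq [IsProbabilityMeasure Q] (hb : IsFilteredBrownian ℱ Q b)
    (hτ : Monotone τ) (hξ : ∀ k, Measurable[ℱ (τ k)] (ξ k)) (hC : ∀ k ω, |ξ k ω| ≤ C) (n : ℕ) :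
    ∫ ω, transform b τ ξ n ω ^ 2 ∂Q = ∫ ω, bracket τ ξ n ω ∂Q := by
  have hξm : ∀ k, Measurable (ξ k) := fun k => (hξ k).mono (ℱ.le _) le_rfl
  have hξb : ∀ k, MemLp (ξ k) ∞ Q := fun k =>
    memLp_top_of_bound (hξm k).aestronglyMeasurable C (.of_forall fun ω => hC k ω)
  induction n with
  | zero => simp [transform, bracket]
  | succ n ih =>
    set Δ : Ω → ℝ := fun ω => b (τ (n + 1)) ω - b (τ n) ω with hΔ
    have hle : τ n ≤ τ (n + 1) := hτ n.le_succ
    have hJ := memLp_transform hb hτ hξ hC n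
    have hξΔ : MemLp (fun ω => ξ n ω * Δ ω) 2 Q :=
      MemLp.mul (p := ∞) (q := 2) (hb.memLp_sub hle) (hξb n)
    have e1 : ∀ ω, transform b τ ξ (n + 1) ω ^ 2 = transform b τ ξ n ω ^ 2
        + (2 * (transform b τ ξ n ω * (ξ n ω * Δ ω)) + (ξ n ω * Δ ω) ^ 2) := fun ω => by
      simp only [transform, Finset.sum_range_succ, hΔ]; ring
    have e2 : ∀ ω, bracket τ ξ (n + 1) ω = bracket τ ξ n ω
        + ξ n ω ^ 2 * ((τ (n + 1) : ℝ) - τ n) := fun ω => by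
      simp only [bracket, Finset.sum_range_succ]
    have hξ2 : Integrable (fun ω => ξ n ω ^ 2) Q := by
      exact ((hξb n).mono_exponent le_top : MemLp (ξ n) 2 Q).integrable_sq
    have hbr : Integrable (bracket τ ξ n) Q := by
      unfold bracket
      refine integrable_finsetSum _ fun k _ => Integrable.mul_const ?_ _
      exact ((hξb k).mono_exponent le_top : MemLp (ξ k) 2 Q).integrable_sq
    -- A factor known at `τ n` times a centred increment independent of `ℱ (τ n)`: the orthogonality
    -- behind the isometry.
    have hcross : ∫ ω, transform b τ ξ n ω * (ξ n ω * Δ ω) ∂Q = 0 := by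
      have hmul : Measurable[ℱ (τ n)] fun ω => transform b τ ξ n ω * ξ n ω :=
        (measurable_transform hb hτ hξ n).mul (hξ n)
      have hind := hb.indepFun hle hmul
      have := hind.integral_fun_mul_eq_mul_integral
        (hmul.mono (ℱ.le _) le_rfl).aestronglyMeasurable (hb.memLp_sub hle).1
      rw [hb.integral_sub hle, mul_zero] at this
      rw [← this]
      exact integral_congr_ae (.of_forall fun ω => by simp only [hΔ]; ring)
    have hsq : ∫ ω, (ξ n ω * Δ ω) ^ 2 ∂Q
        = ∫ ω, ξ n ω ^ 2 * ((τ (n + 1) : ℝ) - τ n) ∂Q := by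
      have hind := (hb.indepFun hle (hξ n)).comp (φ := fun x : ℝ => x ^ 2)
        (ψ := fun x : ℝ => x ^ 2) (by fun_prop) (by fun_prop)
      have := hind.integral_fun_mul_eq_mul_integral
        ((hξm n).pow_const 2).aestronglyMeasurable ((hb.memLp_sub hle).1.pow 2)
      simp only [Function.comp_apply] at this
      rw [hb.integral_sub_sq hle] at this
      rw [integral_mul_const, ← this]
      exact integral_congr_ae (.of_forall fun ω => by simp only [hΔ]; ring)
    have hI1 : Integrable (fun ω => transform b τ ξ n ω * (ξ n ω * Δ ω)) Q :=
      hJ.integrable_mul hξΔ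
    have hI2 : Integrable (fun ω => 2 * (transform b τ ξ n ω * (ξ n ω * Δ ω))
        + (ξ n ω * Δ ω) ^ 2) Q := (hI1.const_mul 2).add hξΔ.integrable_sq
    simp_rw [e1, e2]
    rw [integral_add hJ.integrable_sq hI2,
      integral_add (hI1.const_mul 2) hξΔ.integrable_sq, integral_const_mul, hcross, hsq,
      integral_add hbr (hξ2.mul_const _), ih]
    ring

theorem bracket_mono (hτ : Monotone τ) (ω : Ω) : Monotone fun n => bracket τ ξ n ω := by
  refine monotone_nat_of_le_succ fun n => ?_
  simp only [bracket, Finset.sum_range_succ, le_add_iff_nonneg_right]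
  have : (τ n : ℝ) ≤ τ (n + 1) := by exact_mod_cast hτ n.le_succ
  exact mul_nonneg (sq_nonneg _) (by linarith)

/-- Lenglart's inequality for martingale transforms. -/
theorem measure_le_abs_transform [IsProbabilityMeasure Q] (hb : IsFilteredBrownian ℱ Q b)
    (hτ : Monotone τ) (hξ : ∀ k, Measurable[ℱ (τ k)] (ξ k)) (hC : ∀ k ω, |ξ k ω| ≤ C) (n : ℕ)
    {ε δ : ℝ} (hε : 0 < ε) (hδ : 0 < δ) :
    Q {ω | ε ≤ |transform b τ ξ n ω|}
      ≤ Q {ω | δ < bracket τ ξ n ω} + ENNReal.ofReal (δ / ε ^ 2) := by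
  -- `ξ k` is switched off as soon as its own contribution would push the bracket above `δ`. The new
  -- coefficients are still adapted, their bracket never exceeds `δ`, and the transform is unchanged
  -- where the original bracket stays below `δ`. Chebyshev and the isometry then apply to `ζ`.
  set ζ : ℕ → Ω → ℝ := fun k => {ω | bracket τ ξ (k + 1) ω ≤ δ}.indicator (ξ k) with hζ
  have hζm : ∀ k, Measurable[ℱ (τ k)] (ζ k) := fun k =>
    (hξ k).indicator (measurableSet_le (measurable_bracket hτ hξ k) measurable_const)
  have hζC : ∀ k ω, |ζ k ω| ≤ C := fun k ω => by
    simp only [hζ, Set.indicator_apply]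
    split_ifs
    · exact hC k ω
    · simpa using (abs_nonneg _).trans (hC k ω)
  have hbr : ∀ m ω, bracket τ ζ m ω ≤ δ := by
    intro m ω
    induction m with
    | zero => simpa [bracket] using hδ.le
    | succ m ih =>
      by_cases h : bracket τ ξ (m + 1) ω ≤ δ
      · have : bracket τ ζ (m + 1) ω = bracket τ ξ (m + 1) ω := by
          unfold bracket
          refine Finset.sum_congr rfl fun k hk => ?_
          have : bracket τ ξ (k + 1) ω ≤ δ :=
            (bracket_mono hτ ω (by have := Finset.mem_range.1 hk; omega)).trans h
          simp [hζ, this]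
        rw [this]; exact h
      · have : bracket τ ζ (m + 1) ω = bracket τ ζ m ω := by
          have h0 : ζ m ω = 0 := Set.indicator_of_notMem (by exact h) _
          simp [bracket, Finset.sum_range_succ, h0]
        rw [this]; exact ih
  have heq : ∀ ω, ¬ δ < bracket τ ξ n ω → transform b τ ξ n ω = transform b τ ζ n ω := by
    intro ω hω
    unfold transform
    refine Finset.sum_congr rfl fun k hk => ?_
    have : bracket τ ξ (k + 1) ω ≤ δ :=
      (bracket_mono hτ ω (Finset.mem_range.1 hk)).trans (not_lt.1 hω)
    simp [hζ, this]
  have hsub : {ω | ε ≤ |transform b τ ξ n ω|} ⊆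
      {ω | δ < bracket τ ξ n ω} ∪ {ω | ε ^ 2 ≤ transform b τ ζ n ω ^ 2} := by
    intro ω hω
    by_cases h : δ < bracket τ ξ n ω
    · exact Or.inl h
    · right
      have hω' : ε ≤ |transform b τ ξ n ω| := hω
      rw [heq ω h] at hω'
      show ε ^ 2 ≤ _
      rw [← sq_abs (transform b τ ζ n ω)]
      gcongr
  refine (measure_mono hsub).trans ((measure_union_le _ _).trans ?_)
  gcongr
  have hL := memLp_transform hb hτ hζm hζC n
  have hmk := mul_meas_ge_le_integral_of_nonneg (μ := Q)
    (f := fun ω => transform b τ ζ n ω ^ 2) (.of_forall fun ω => sq_nonneg _)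
    hL.integrable_sq (ε ^ 2)
  have hint : ∫ ω, transform b τ ζ n ω ^ 2 ∂Q ≤ δ := by
    rw [integral_transform_sq hb hτ hζm hζC n]
    by_cases hi : Integrable (bracket τ ζ n) Q
    · calc ∫ ω, bracket τ ζ n ω ∂Q ≤ ∫ _, δ ∂Q :=
            integral_mono hi (integrable_const _) fun ω => hbr n ω
        _ = δ := by simp
    -- Without integrability the Bochner integral is 0 by convention, and the bound still holds.
    · rw [integral_undef hi]; exact hδ.le
  rw [← ofReal_measureReal]
  refine ENNReal.ofReal_le_ofReal ?_
  rw [le_div_iff₀ (by positivity), mul_comm]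
  exact hmk.trans hint

end MartingaleTransform

end StochCov

/-! ### Grids adapted to elementary processes -/

namespace StochCov

/-- Every finite subset of `[0, T]` is contained in a grid running from `0` to `T`. -/
theorem exists_monotone_grid (P : Finset ℝ≥0) (T : ℝ≥0) (hP : ∀ p ∈ P, p ≤ T) :
    ∃ (N : ℕ) (τ : ℕ → ℝ≥0), Monotone τ ∧ τ 0 = 0 ∧ τ N = T ∧ (∀ k, τ k ≤ T) ∧
      ∀ p ∈ P, ∃ k, τ k = p := by
  set S : Finset ℝ≥0 := insert 0 (insert T P) with hS
  have hST : ∀ p ∈ S, p ≤ T := by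
    intro p hp
    simp only [hS, Finset.mem_insert] at hp
    rcases hp with rfl | rfl | hp
    · exact zero_le
    · exact le_rfl
    · exact hP p hp
  have h0S : (0 : ℝ≥0) ∈ S := by simp [hS]
  have hTS : T ∈ S := by simp [hS]
  have hcard : 0 < S.card := Finset.card_pos.2 ⟨0, h0S⟩
  set e := S.orderEmbOfFin rfl with he
  -- The increasing enumeration of `S`, continued by the constant `T`; its last proper index is
  -- `S.card - 1`.
  set τ : ℕ → ℝ≥0 := fun k => if h : k < S.card then e ⟨k, h⟩ else T with hτ
  have hle : ∀ k, τ k ≤ T := by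
    intro k
    simp only [hτ]
    split_ifs with h
    · exact hST _ (Finset.orderEmbOfFin_mem _ _ _)
    · exact le_rfl
  have hmono : Monotone τ := by
    intro a b hab
    by_cases hb : b < S.card
    · have ha : a < S.card := hab.trans_lt hb
      simp only [hτ, ha, hb, dif_pos]
      exact e.monotone hab
    · have : τ b = T := by simp [hτ, hb]
      rw [this]; exact hle a
  have hsurj : ∀ p ∈ S, ∃ k, k < S.card ∧ τ k = p := by
    intro p hp
    have : p ∈ Set.range e := by rw [he, Finset.range_orderEmbOfFin]; exact hp
    obtain ⟨⟨k, hk⟩, rfl⟩ := this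
    exact ⟨k, hk, by simp [hτ, hk]⟩
  refine ⟨S.card - 1, τ, hmono, ?_, ?_, hle, fun p hp => ?_⟩
  · obtain ⟨k, -, hk⟩ := hsurj 0 h0S
    exact le_antisymm ((hmono k.zero_le).trans hk.le) zero_le
  · obtain ⟨k, hk, hkT⟩ := hsurj T hTS
    exact le_antisymm (hle _) (hkT.symm.le.trans (hmono (by omega)))
  · obtain ⟨k, -, hk⟩ := hsurj p (by simp [hS, hp])
    exact ⟨k, hk⟩

namespace ElementaryProcess

variable {Ω : Type*} {mΩ : MeasurableSpace Ω} {ℱ : Filtration ℝ≥0 mΩ}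
  {Q : Measure Ω} {B : ℝ≥0 → Ω → Plane} {T : ℝ≥0}

/-- A grid from `0` to `T` on whose cells the elementary process `G` is constant in time. -/
structure IsGrid (G : ElementaryProcess ℱ) (T : ℝ≥0) (N : ℕ) (τ : ℕ → ℝ≥0) : Prop where
  mono : Monotone τ
  zero : τ 0 = 0
  last : τ N = T
  le : ∀ k, τ k ≤ T
  left_le : ∀ k j, G.left j < τ (k + 1) → G.left j ≤ τ k
  le_right : ∀ k j, τ k < G.right j → τ (k + 1) ≤ G.right j

theorem exists_isGrid (G : ElementaryProcess ℱ) (T : ℝ≥0) : ∃ N τ, G.IsGrid T N τ := by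
  classical
  obtain ⟨N, τ, hmono, h0, hN, hle, hP⟩ := exists_monotone_grid
    (Finset.univ.image (fun j => min (G.left j) T) ∪ Finset.univ.image fun j => min (G.right j) T)
    T (by
      intro p hp
      simp only [Finset.mem_union, Finset.mem_image, Finset.mem_univ, true_and] at hp
      rcases hp with ⟨j, rfl⟩ | ⟨j, rfl⟩ <;> exact min_le_right _ _)
  refine ⟨N, τ, hmono, h0, hN, hle, fun k j hlt => ?_, fun k j hlt => ?_⟩
  -- The grid contains the end points cut off at `T`. Here the cut has no effect, since `G.left j`
  -- lies before a grid point.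
  · obtain ⟨a, ha⟩ := hP (min (G.left j) T) (by simp)
    rw [min_eq_left (hlt.le.trans (hle _))] at ha
    rw [← ha] at hlt ⊢
    exact hmono (Nat.lt_succ_iff.1 (hmono.reflect_lt hlt))
  · obtain ⟨a, ha⟩ := hP (min (G.right j) T) (by simp)
    rcases le_or_gt (k + 1) a with h | h
    · exact (hmono h).trans (ha.le.trans (min_le_left _ _))
    · have h1 : min (G.right j) T ≤ τ k := ha.symm.le.trans (hmono (by omega))
      rcases min_le_iff.1 h1 with h2 | h2
      · exact absurd hlt (not_lt.2 h2)
      · exact (hle _).trans (h2.trans hlt.le)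

theorem value_apply (G : ElementaryProcess ℱ) (t : ℝ≥0) (ω : Ω) (i j : Fin 2) :
    G.value t ω i j = ∑ k, if G.left k < t ∧ t ≤ G.right k then G.coeff k ω i j else 0 := by
  simp only [value, Matrix.sum_apply, Set.indicator_apply, Set.mem_Ioc]
  refine Finset.sum_congr rfl fun k _ => ?_
  split_ifs <;> rfl

theorem integral_apply (G : ElementaryProcess ℱ) (B : ℝ≥0 → Ω → Plane) (t : ℝ≥0) (ω : Ω)
    (i : Fin 2) : G.integral B t ω i = ∑ k, ∑ j, G.coeff k ω i j *
      (B (min (G.right k) t) ω j - B (min (G.left k) t) ω j) := by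
  fin_cases i <;> simp [integral]

theorem exists_bound_value (G : ElementaryProcess ℱ) :
    ∃ C : ℝ, ∀ t ω i j, |G.value t ω i j| ≤ C := by
  obtain ⟨C, hC⟩ := G.bounded_coeff
  refine ⟨∑ _k : Fin G.n, |C|, fun t ω i j => ?_⟩
  rw [value_apply]
  refine (Finset.abs_sum_le_sum_abs _ _).trans (Finset.sum_le_sum fun k _ => ?_)
  split_ifs
  · exact (hC k ω i j).trans (le_abs_self C)
  · simp

namespace IsGrid

variable {G : ElementaryProcess ℱ} {N : ℕ} {τ : ℕ → ℝ≥0}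

theorem value_eq (h : G.IsGrid T N τ) {k : ℕ} {t : ℝ≥0} (ht : t ∈ Set.Ioc (τ k) (τ (k + 1)))
    (ω : Ω) : G.value t ω = G.value (τ (k + 1)) ω := by
  ext i j
  rw [value_apply, value_apply]
  refine Finset.sum_congr rfl fun l _ => ?_
  have e : (G.left l < t ∧ t ≤ G.right l) ↔ (G.left l < τ (k + 1) ∧ τ (k + 1) ≤ G.right l) :=
    ⟨fun ⟨h1, h2⟩ => ⟨h1.trans_le ht.2, h.le_right k l (ht.1.trans_le h2)⟩,
      fun ⟨h1, h2⟩ => ⟨(h.left_le k l h1).trans_lt ht.1, ht.2.trans h2⟩⟩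
  simp only [e]

/-- A term active at `τ (k + 1)` starts strictly before it, hence no later than `τ k` by the grid
property. Evaluating at the right end, as the half-open intervals `(a, b]` require, therefore does
not anticipate. -/
theorem measurable_value (h : G.IsGrid T N τ) (k : ℕ) (i j : Fin 2) :
    Measurable[ℱ (τ k)] fun ω => G.value (τ (k + 1)) ω i j := by
  simp_rw [value_apply]
  refine Finset.measurable_sum _ fun l _ => ?_
  by_cases hl : G.left l < τ (k + 1) ∧ τ (k + 1) ≤ G.right l
  · simp only [hl, and_self, if_true]
    exact (G.measurable_coeff l i j).mono (ℱ.mono (h.left_le k l hl.1)) le_rfl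
  · simp only [hl, if_false]
    exact measurable_const

/-- On every cell, whether before, inside or after `(a, b]`, a term contributes the increment of `t
↦ ξ (B_{b ∧ t} - B_{a ∧ t})`, and these telescope. The scalar results on transforms thereby apply to
elementary integrals. -/
theorem integral_eq (h : G.IsGrid T N τ) (B : ℝ≥0 → Ω → Plane) (ω : Ω) (i : Fin 2) :
    G.integral B T ω i = ∑ j, transform (fun t ω => B t ω j) τ
      (fun k ω => G.value (τ (k + 1)) ω i j) N ω := by
  rw [integral_apply, Finset.sum_comm]
  refine Finset.sum_congr rfl fun j _ => ?_
  simp only [transform, value_apply, Finset.sum_mul]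
  rw [Finset.sum_comm]
  refine Finset.sum_congr rfl fun l _ => ?_
  have step : ∀ k, (if G.left l < τ (k + 1) ∧ τ (k + 1) ≤ G.right l then G.coeff l ω i j else 0) *
      (B (τ (k + 1)) ω j - B (τ k) ω j) =
      G.coeff l ω i j * (B (min (G.right l) (τ (k + 1))) ω j - B (min (G.left l) (τ (k + 1))) ω j)
      - G.coeff l ω i j * (B (min (G.right l) (τ k)) ω j - B (min (G.left l) (τ k)) ω j) := by
    intro k
    have hk : τ k ≤ τ (k + 1) := h.mono k.le_succ
    by_cases h1 : G.left l < τ (k + 1)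
    · have h1' := h.left_le k l h1
      by_cases h2 : τ (k + 1) ≤ G.right l
      · rw [if_pos ⟨h1, h2⟩, min_eq_right h2, min_eq_right (hk.trans h2), min_eq_left h1.le,
          min_eq_left h1']
        ring
      · have h3 : G.right l ≤ τ k := not_lt.1 fun h' => h2 (h.le_right k l h')
        rw [if_neg fun h' => h2 h'.2, min_eq_left (h3.trans hk), min_eq_left h3, min_eq_left h1.le,
          min_eq_left h1']
        ring
    · have h2 : τ (k + 1) ≤ G.left l := not_lt.1 h1
      have h3 := h2.trans (G.left_le_right l)
      rw [if_neg fun h' => h1 h'.1, min_eq_right h3, min_eq_right h2, min_eq_right (hk.trans h3),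
        min_eq_right (hk.trans h2)]
      ring
  simp_rw [step]
  rw [Finset.sum_range_sub (fun k => G.coeff l ω i j *
    (B (min (G.right l) (τ k)) ω j - B (min (G.left l) (τ k)) ω j)), h.last, h.zero]
  simp

theorem intervalIntegrable (h : G.IsGrid T N τ) (F : Mat → ℝ) (ω : Ω) (k : ℕ) :
    IntervalIntegrable (fun s : ℝ => F (G.value s.toNNReal ω)) volume (τ k) (τ (k + 1)) ∧
    ∫ s in (τ k : ℝ)..(τ (k + 1)), F (G.value s.toNNReal ω)
      = F (G.value (τ (k + 1)) ω) * ((τ (k + 1) : ℝ) - τ k) := by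
  have hk : (τ k : ℝ) ≤ τ (k + 1) := by exact_mod_cast h.mono k.le_succ
  have hc : Set.EqOn (fun _ : ℝ => F (G.value (τ (k + 1)) ω))
      (fun s : ℝ => F (G.value s.toNNReal ω)) (Set.Ioc (τ k : ℝ) (τ (k + 1))) := by
    intro s hs
    have : s.toNNReal ∈ Set.Ioc (τ k) (τ (k + 1)) :=
      ⟨Real.lt_toNNReal_iff_coe_lt.2 hs.1, Real.toNNReal_le_iff_le_coe.2 hs.2⟩
    simp only [h.value_eq this]
  constructor
  · rw [intervalIntegrable_iff_integrableOn_Ioc_of_le hk]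
    exact (integrableOn_const (by simp)).congr_fun hc measurableSet_Ioc
  · rw [intervalIntegral.integral_of_le hk, ← setIntegral_congr_fun measurableSet_Ioc hc,
      setIntegral_const]
    simp [hk, mul_comm]

theorem integral_comp_value (h : G.IsGrid T N τ) (F : Mat → ℝ) (ω : Ω) :
    IntervalIntegrable (fun s : ℝ => F (G.value s.toNNReal ω)) volume 0 T ∧
    ∫ s in (0 : ℝ)..T, F (G.value s.toNNReal ω)
      = ∑ k ∈ Finset.range N, F (G.value (τ (k + 1)) ω) * ((τ (k + 1) : ℝ) - τ k) := by
  have h0 : ((τ 0 : ℝ≥0) : ℝ) = 0 := by simp [h.zero]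
  have hN : ((τ N : ℝ≥0) : ℝ) = T := by simp [h.last]
  constructor
  · rw [← h0, ← hN]
    exact IntervalIntegrable.trans_iterate (a := fun k => (τ k : ℝ))
      fun k _ => (h.intervalIntegrable F ω k).1
  · rw [← h0, ← hN, ← intervalIntegral.sum_integral_adjacent_intervals (a := fun k => (τ k : ℝ))
      fun k _ => (h.intervalIntegrable F ω k).1]
    exact Finset.sum_congr rfl fun k _ => (h.intervalIntegrable F ω k).2

end IsGrid

/-- The difference of two elementary processes. -/
def sub (G K : ElementaryProcess ℱ) : ElementaryProcess ℱ where
  n := G.n + K.n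
  left := Fin.append G.left K.left
  right := Fin.append G.right K.right
  coeff := Fin.append G.coeff fun k ω => -K.coeff k ω
  left_le_right k := by
    refine Fin.addCases (fun l => ?_) (fun l => ?_) k
    · simpa using G.left_le_right l
    · simpa using K.left_le_right l
  measurable_coeff k i j := by
    refine Fin.addCases (fun l => ?_) (fun l => ?_) k
    · rw [Fin.append_left, Fin.append_left]; exact G.measurable_coeff l i j
    · rw [Fin.append_right, Fin.append_right]; exact (K.measurable_coeff l i j).neg
  bounded_coeff := by
    obtain ⟨C, hC⟩ := G.bounded_coeff
    obtain ⟨D, hD⟩ := K.bounded_coeff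
    refine ⟨max C D, fun k ω i j => ?_⟩
    refine Fin.addCases (fun l => ?_) (fun l => ?_) k
    · rw [Fin.append_left]; exact (hC l ω i j).trans (le_max_left _ _)
    · rw [Fin.append_right, Matrix.neg_apply, abs_neg]
      exact (hD l ω i j).trans (le_max_right _ _)

theorem value_sub (G K : ElementaryProcess ℱ) (t : ℝ≥0) (ω : Ω) (i j : Fin 2) :
    (G.sub K).value t ω i j = G.value t ω i j - K.value t ω i j := by
  rw [value_apply, value_apply, value_apply]
  change ∑ k : Fin (G.n + K.n), _ = _
  rw [Fin.sum_univ_add, sub_eq_add_neg, ← Finset.sum_neg_distrib]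
  congr 1
  · refine Finset.sum_congr rfl fun k _ => ?_
    simp [sub]
  · refine Finset.sum_congr rfl fun k _ => ?_
    simp only [sub, Fin.append_right]
    split_ifs <;> simp

theorem integral_sub (G K : ElementaryProcess ℱ) (B : ℝ≥0 → Ω → Plane) (t : ℝ≥0) (ω : Ω) :
    (G.sub K).integral B t ω = G.integral B t ω - K.integral B t ω := by
  ext i
  rw [PiLp.sub_apply, integral_apply, integral_apply, integral_apply]
  change ∑ k : Fin (G.n + K.n), _ = _
  rw [Fin.sum_univ_add, sub_eq_add_neg, ← Finset.sum_neg_distrib]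
  congr 1
  · refine Finset.sum_congr rfl fun k _ => ?_
    simp [sub]
  · refine Finset.sum_congr rfl fun k _ => ?_
    simp only [sub, Fin.append_right, ← Finset.sum_neg_distrib, Matrix.neg_apply, neg_mul]

end ElementaryProcess

end StochCov

/-! ### Continuity in probability of the elementary integral -/

namespace StochCov

variable {Ω : Type*} {mΩ : MeasurableSpace Ω} {ℱ : Filtration ℝ≥0 mΩ}
  {Q : Measure Ω} {B : ℝ≥0 → Ω → Plane} {T : ℝ≥0}

theorem IsPlanarBrownian.isFilteredBrownian (hB : IsPlanarBrownian ℱ Q B) (j : Fin 2) :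
    IsFilteredBrownian ℱ Q fun t ω => B t ω j where
  brownian := (hB.component j).toIsPreBrownianReal
  adapted t := by
    have : Measurable fun x : Plane => x j := by fun_prop
    exact this.comp (hB.adapted t)
  indep s t hst := by
    refine indep_of_indep_of_le_left (hB.indep_increments s t hst) ?_
    have : Measurable fun x : Plane => x j := by fun_prop
    have e : (fun ω => B t ω j - B s ω j) = (fun x : Plane => x j) ∘ fun ω => B t ω - B s ω := by
      ext ω; simp
    rw [e, ← MeasurableSpace.comap_comp]
    exact MeasurableSpace.comap_mono this.comap_le

namespace ElementaryProcess

/-- Lenglart's inequality for the stochastic integral of an elementary process. -/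
theorem measure_le_norm_integral [IsProbabilityMeasure Q] (hB : IsPlanarBrownian ℱ Q B)
    (D : ElementaryProcess ℱ) (T : ℝ≥0) {ε δ : ℝ} (hε : 0 < ε) (hδ : 0 < δ) :
    Q {ω | ε ≤ ‖D.integral B T ω‖} ≤
      4 * (Q {ω | δ ≤ ∫ s in (0 : ℝ)..T, ∑ i, ∑ j, D.value s.toNNReal ω i j ^ 2}
        + ENNReal.ofReal (δ / (ε / 4) ^ 2)) := by
  obtain ⟨N, τ, h⟩ := D.exists_isGrid T
  obtain ⟨C, hC⟩ := D.exists_bound_value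
  set ξ : Fin 2 → Fin 2 → ℕ → Ω → ℝ := fun i j k ω => D.value (τ (k + 1)) ω i j with hξ
  set J : Fin 2 → Fin 2 → Ω → ℝ := fun i j => transform (fun t ω => B t ω j) τ (ξ i j) N with hJ
  -- The norm is at most the sum of four scalar transforms, one per matrix entry, so one of them
  -- reaches `ε / 4`.
  have hsub : {ω | ε ≤ ‖D.integral B T ω‖} ⊆ ⋃ p : Fin 2 × Fin 2, {ω | ε / 4 ≤ |J p.1 p.2 ω|} := by
    intro ω hω
    by_contra hcon
    simp only [Set.mem_iUnion, not_exists, Set.mem_ofPred_eq, not_le] at hcon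
    have hnorm : ‖D.integral B T ω‖ ≤ |D.integral B T ω 0| + |D.integral B T ω 1| := by
      rw [EuclideanSpace.norm_eq, Fin.sum_univ_two, Real.norm_eq_abs, Real.norm_eq_abs]
      refine Real.sqrt_le_iff.2 ⟨by positivity, ?_⟩
      nlinarith [abs_nonneg (D.integral B T ω 0), abs_nonneg (D.integral B T ω 1)]
    have hc : ∀ i, |D.integral B T ω i| ≤ |J i 0 ω| + |J i 1 ω| := by
      intro i
      rw [h.integral_eq, Fin.sum_univ_two]
      exact abs_add_le _ _
    have hω' : ε ≤ ‖D.integral B T ω‖ := hω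
    linarith [hc 0, hc 1, hcon (0, 0), hcon (0, 1), hcon (1, 0), hcon (1, 1)]
  -- Each entry's bracket is below the integrated squared Frobenius norm, so one exceptional event
  -- serves all four entries.
  have hbr : ∀ i j ω, bracket τ (ξ i j) N ω
      ≤ ∫ s in (0 : ℝ)..T, ∑ i, ∑ j, D.value s.toNNReal ω i j ^ 2 := by
    intro i j ω
    rw [(h.integral_comp_value (fun M => ∑ i, ∑ j, M i j ^ 2) ω).2]
    refine Finset.sum_le_sum fun k _ => ?_
    have hk : (τ k : ℝ) ≤ τ (k + 1) := by exact_mod_cast h.mono k.le_succ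
    refine mul_le_mul_of_nonneg_right ?_ (by linarith)
    exact (Finset.single_le_sum (f := fun j => D.value (τ (k + 1)) ω i j ^ 2)
      (fun _ _ => sq_nonneg _) (Finset.mem_univ j)).trans
      (Finset.single_le_sum (f := fun i => ∑ j, D.value (τ (k + 1)) ω i j ^ 2)
      (fun _ _ => Finset.sum_nonneg fun _ _ => sq_nonneg _) (Finset.mem_univ i))
  refine (measure_mono hsub).trans ((measure_iUnion_fintype_le _ _).trans ?_)
  have hp : ∀ p : Fin 2 × Fin 2, Q {ω | ε / 4 ≤ |J p.1 p.2 ω|} ≤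
      Q {ω | δ ≤ ∫ s in (0 : ℝ)..T, ∑ i, ∑ j, D.value s.toNNReal ω i j ^ 2}
        + ENNReal.ofReal (δ / (ε / 4) ^ 2) := by
    intro p
    refine (measure_le_abs_transform (hB.isFilteredBrownian p.2) h.mono
      (fun k => h.measurable_value k p.1 p.2) (fun k ω => hC _ ω _ _) N (by positivity) hδ).trans ?_
    gcongr with ω
    exact fun hω => hω.le.trans (hbr _ _ ω)
  refine (Finset.sum_le_sum fun p _ => hp p).trans ?_
  simp [mul_add]

/-- Elementary integrals converge to zero in probability if their integrands do so in `L²` of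
time. -/
theorem tendstoInMeasure_integral [IsProbabilityMeasure Q] (hB : IsPlanarBrownian ℱ Q B)
    {D : ℕ → ElementaryProcess ℱ} (hD : TendstoInMeasure Q
      (fun n ω => ∫ s in (0 : ℝ)..T, ∑ i, ∑ j, (D n).value s.toNNReal ω i j ^ 2)
      atTop fun _ => 0) :
    TendstoInMeasure Q (fun n => (D n).integral B T) atTop fun _ => 0 := by
  rw [tendstoInMeasure_iff_norm] at hD ⊢
  intro ε hε
  rw [ENNReal.tendsto_nhds_zero]
  intro ρ hρ
  -- `δ` is fixed first, making the second term of Lenglart's bound small for all `n` at once; the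
  -- first is then small for large `n`.
  obtain ⟨δ, hδ, hδρ⟩ : ∃ δ : ℝ, 0 < δ ∧ 4 * ENNReal.ofReal (δ / (ε / 4) ^ 2) ≤ ρ / 2 := by
    have hlim : Tendsto (fun δ : ℝ => 4 * ENNReal.ofReal (δ / (ε / 4) ^ 2)) (𝓝[>] 0) (𝓝 0) := by
      have h1 : Tendsto (fun δ : ℝ => δ / (ε / 4) ^ 2) (𝓝[>] 0) (𝓝 0) := by
        have : Continuous fun δ : ℝ => δ / (ε / 4) ^ 2 := by fun_prop
        simpa using (this.tendsto 0).mono_left nhdsWithin_le_nhds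
      have h2 := ENNReal.Tendsto.const_mul (a := 4) (ENNReal.tendsto_ofReal h1) (Or.inr (by simp))
      simpa using h2
    have hev := (hlim.eventually_le_const (ENNReal.half_pos hρ.ne')).and self_mem_nhdsWithin
    obtain ⟨δ, h1, h2⟩ := hev.exists
    exact ⟨δ, h2, h1⟩
  have hD' := ENNReal.Tendsto.const_mul (a := 4) (hD δ hδ) (Or.inr (by simp))
  rw [mul_zero] at hD'
  filter_upwards [hD'.eventually_le_const (ENNReal.half_pos hρ.ne')] with n hn
  simp only [sub_zero] at hn ⊢
  refine ((D n).measure_le_norm_integral hB T hε hδ).trans ?_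
  rw [mul_add, ← ENNReal.add_halves ρ]
  refine add_le_add (le_trans ?_ hn) hδρ
  gcongr with ω
  exact Real.le_norm_self _

end ElementaryProcess

end StochCov

/-! ### Discretising bounded progressive processes -/

namespace StochCov

variable {Ω : Type*} {mΩ : MeasurableSpace Ω} {ℱ : Filtration ℝ≥0 mΩ} {Q : Measure Ω} {T : ℝ≥0}

/-- A progressive process, stopped at `T`, is jointly measurable. -/
theorem measurable_uncurry_min {x : ℝ≥0 → Ω → ℝ} (hx : IsStronglyProgressive ℱ x) (T : ℝ≥0) :
    Measurable fun p : ℝ × Ω => x (min p.1.toNNReal T) p.2 := by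
  have h1 := (hx T).measurable
  have h2 : @Measurable (ℝ × Ω) (Set.Iic T × Ω) _ (Subtype.instMeasurableSpace.prod (ℱ T))
      fun p : ℝ × Ω => ((⟨min p.1.toNNReal T, Set.mem_Iic.2 (min_le_right _ _)⟩ : Set.Iic T), p.2) := by
    refine @Measurable.prodMk _ _ _ _ _ (ℱ T) _ _ ?_ ?_
    · exact Measurable.subtype_mk (by fun_prop)
    · exact measurable_snd.mono le_rfl (ℱ.le T)
  exact h1.comp h2

/-- The σ-algebra generated by a matrix-valued path up to time `T`. -/
abbrev pathAlgebra (X : ℝ≥0 → Ω → Mat) (T : ℝ≥0) : MeasurableSpace Ω :=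
  MeasurableSpace.comap (covPath X T) inferInstance

theorem measurable_pathAlgebra_entry (X : ℝ≥0 → Ω → Mat) {t : ℝ≥0} (ht : t ≤ T) (i j : Fin 2) :
    Measurable[pathAlgebra X T] fun ω => X t ω i j := by
  have : Measurable fun x : Set.Iic T → Fin 2 → Fin 2 → ℝ => x ⟨t, ht⟩ i j := by fun_prop
  exact this.comp (comap_measurable (covPath X T))

theorem measurable_covPath {m : MeasurableSpace Ω} {X : ℝ≥0 → Ω → Mat}
    (hX : ∀ t ≤ T, ∀ i j, Measurable fun ω => X t ω i j) : Measurable (covPath X T) :=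
  measurable_pi_lambda _ fun t => measurable_pi_lambda _ fun i => measurable_pi_lambda _ fun j =>
    hX t t.2 i j

theorem exists_mem_Ioc_grid {s δ t : ℝ} {n : ℕ} (ht : t ∈ Set.Ioc s (s + n * δ)) :
    ∃ k < n, t ∈ Set.Ioc (s + k * δ) (s + (k + 1) * δ) := by
  induction n with
  | zero => simp at ht
  | succ n ih =>
    by_cases h : t ≤ s + n * δ
    · obtain ⟨k, hk, hkt⟩ := ih ⟨ht.1, h⟩
      exact ⟨k, hk.trans n.lt_succ_self, hkt⟩
    · exact ⟨n, n.lt_succ_self, not_le.1 h, by have := ht.2; push_cast at this; exact this⟩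

namespace ElementaryProcess

theorem measurable_uncurry_value (K : ElementaryProcess ℱ) (i j : Fin 2) :
    Measurable fun p : ℝ × Ω => K.value p.1.toNNReal p.2 i j := by
  simp_rw [value_apply]
  refine Finset.measurable_sum _ fun k _ => Measurable.ite ?_ ?_ measurable_const
  · exact (measurableSet_lt measurable_const (by fun_prop)).inter
      (measurableSet_le (by fun_prop) measurable_const)
  · exact ((K.measurable_coeff k i j).mono (ℱ.le _) le_rfl).comp measurable_snd

/-- The left-point discretisation of a bounded progressive process along a uniform grid. -/
theorem exists_discretisation {X : ℝ≥0 → Ω → Mat}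
    (hX : ∀ i j, IsStronglyProgressive ℱ fun t ω => X t ω i j) {C : ℝ}
    (hXC : ∀ t ω i j, |X t ω i j| ≤ C) {n : ℕ} {δ s : ℝ} (hδ : 0 < δ) (hnδ : n * δ = T)
    (hs : s ∈ Set.Ioc 0 δ) :
    ∃ K : ElementaryProcess ℱ,
      (∀ t i j, Measurable[pathAlgebra X T] fun ω => K.value t ω i j) ∧
      (∀ k < n, ∀ t ∈ Set.Ioc (s + k * δ) (s + (k + 1) * δ), ∀ ω i j,
        K.value t.toNNReal ω i j = X (s + k * δ).toNNReal ω i j) ∧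
      (∀ t ∈ Set.Ioc 0 s, ∀ ω i j, K.value t.toNNReal ω i j = 0) := by
  have hleft0 : ∀ k : ℕ, 0 ≤ s + k * δ := fun k => by have := hs.1; positivity
  -- As `s ≤ δ`, all left end points with `k < n` stay in `[0, T]`, so the coefficients depend only
  -- on the path up to `T`. The last right end point lies beyond `T`, which is harmless.
  have hleftT : ∀ k < n, s + k * δ ≤ T := fun k hk => by
    have : (k : ℝ) + 1 ≤ n := by exact_mod_cast hk
    rw [← hnδ]
    nlinarith [hs.2]
  have hleftT' : ∀ k < n, (s + k * δ).toNNReal ≤ T := fun k hk =>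
    Real.toNNReal_le_iff_le_coe.2 (hleftT k hk)
  let K : ElementaryProcess ℱ :=
    { n := n
      left := fun k => (s + k * δ).toNNReal
      right := fun k => (s + (k + 1) * δ).toNNReal
      coeff := fun k ω => X (s + k * δ).toNNReal ω
      left_le_right := fun k => Real.toNNReal_le_toNNReal (by nlinarith)
      measurable_coeff := fun k i j => ((hX i j).stronglyAdapted _).measurable
      bounded_coeff := ⟨C, fun k ω i j => hXC _ ω i j⟩ }
  have hcell : ∀ k < n, ∀ t ∈ Set.Ioc (s + k * δ) (s + (k + 1) * δ), ∀ ω i j,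
      K.value t.toNNReal ω i j = X (s + k * δ).toNNReal ω i j := by
    intro k hk t ht ω i j
    rw [value_apply]
    rw [Finset.sum_eq_single (⟨k, hk⟩ : Fin n)]
    · rw [if_pos]
      exact ⟨(Real.toNNReal_lt_toNNReal_iff ((hleft0 k).trans_lt ht.1)).2 ht.1,
        Real.toNNReal_le_toNNReal ht.2⟩
    · intro l _ hl
      rw [if_neg]
      rintro ⟨h1, h2⟩
      have h1' : s + (l : ℕ) * δ < t :=
        (Real.toNNReal_lt_toNNReal_iff ((hleft0 k).trans_lt ht.1)).1 h1
      have h2' : t ≤ s + ((l : ℕ) + 1) * δ :=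
        (Real.toNNReal_le_toNNReal_iff (by have := hleft0 (l + 1); push_cast at this; exact this)).1 h2
      have hlk : (l : ℕ) ≠ k := fun h => hl (Fin.ext h)
      rcases lt_or_gt_of_ne hlk with h | h
      · have : ((l : ℕ) : ℝ) + 1 ≤ k := by exact_mod_cast h
        nlinarith [ht.1]
      · have : (k : ℝ) + 1 ≤ (l : ℕ) := by exact_mod_cast h
        nlinarith [ht.2]
    · intro h; exact absurd (Finset.mem_univ _) h
  have hzero : ∀ t ∈ Set.Ioc 0 s, ∀ ω i j, K.value t.toNNReal ω i j = 0 := by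
    intro t ht ω i j
    rw [value_apply]
    refine Finset.sum_eq_zero fun l _ => if_neg ?_
    rintro ⟨h1, -⟩
    have h1' : s + (l : ℕ) * δ < t := (Real.toNNReal_lt_toNNReal_iff ht.1).1 h1
    have : 0 ≤ ((l : ℕ) : ℝ) * δ := by positivity
    linarith [ht.2]
  refine ⟨K, fun t i j => ?_, hcell, hzero⟩
  simp_rw [value_apply]
  refine Finset.measurable_sum _ fun k _ => Measurable.ite (by simp) ?_ measurable_const
  exact measurable_pathAlgebra_entry X (hleftT' k k.2) i j

/-- A bounded progressive process is approximated in `L¹` by elementary processes that are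
functions of its path. -/
theorem exists_approx_of_bounded [IsProbabilityMeasure Q] {X : ℝ≥0 → Ω → Mat}
    (hX : ∀ i j, IsStronglyProgressive ℱ fun t ω => X t ω i j) {C : ℝ} (hC : 0 ≤ C)
    (hXC : ∀ t ω i j, |X t ω i j| ≤ C) (hT : 0 < T) {κ : ℝ≥0∞} (hκ : κ ≠ 0) :
    ∃ K : ElementaryProcess ℱ, (∀ t ∈ Set.Ioc (0 : ℝ) T, ∀ ω i j, |K.value t.toNNReal ω i j| ≤ C) ∧
      (∀ t i j, Measurable[pathAlgebra X T] fun ω => K.value t ω i j) ∧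
      ∫⁻ ω, ∫⁻ t in Set.Ioc (0 : ℝ) T, ∑ i, ∑ j,
        ‖K.value t.toNNReal ω i j - X t.toNNReal ω i j‖ₑ ∂volume ∂Q ≤ κ := by
  -- Cutting `X` off outside `[0, T]` gives an integrable function on `ℝ × Ω`; the minimum with `T`
  -- brings in progressive measurability at time `T`.
  set f : ℝ → Ω → Fin 2 → Fin 2 → ℝ := fun t ω i j =>
    (Set.Icc (0 : ℝ) T).indicator (fun t => X (min t.toNNReal T) ω i j) t with hf
  have hfm : StronglyMeasurable (Function.uncurry f) := by
    refine Measurable.stronglyMeasurable ?_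
    refine measurable_pi_lambda _ fun i => measurable_pi_lambda _ fun j => ?_
    have : (fun p : ℝ × Ω => Function.uncurry f p i j) = (Set.Icc (0 : ℝ) T ×ˢ Set.univ).indicator
        (fun p => X (min p.1.toNNReal T) p.2 i j) := by
      ext p
      simp only [Function.uncurry, hf, Set.indicator_apply, Set.mem_prod, Set.mem_univ, and_true]
    rw [this]
    exact (measurable_uncurry_min (hX i j) T).indicator
      (measurableSet_Icc.prod MeasurableSet.univ)
  have hfC : ∀ t ω, ‖f t ω‖ ≤ C := fun t ω =>
    (pi_norm_le_iff_of_nonneg hC).2 fun i => (pi_norm_le_iff_of_nonneg hC).2 fun j => by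
      simp only [hf, Set.indicator_apply]
      split_ifs
      · exact hXC _ _ _ _
      · simpa using hC
  have hfi : Integrable (Function.uncurry f) (volume.prod Q) := by
    have hs : MeasurableSet (Set.Icc (0 : ℝ) T ×ˢ (Set.univ : Set Ω)) :=
      measurableSet_Icc.prod MeasurableSet.univ
    have hio : IntegrableOn (Function.uncurry f) (Set.Icc (0 : ℝ) T ×ˢ Set.univ)
        (volume.prod Q) := by
      refine Measure.integrableOn_of_bounded (M := C) ?_ hfm.aestronglyMeasurable
        (.of_forall fun p => hfC _ _)
      rw [Measure.prod_prod]
      simp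
    refine hio.integrable_of_forall_notMem_eq_zero fun p hp => ?_
    have : p.1 ∉ Set.Icc (0 : ℝ) T := fun h => hp ⟨h, trivial⟩
    ext i j
    simp [Function.uncurry, hf, this]
  have hfX : ∀ t ∈ Set.Icc (0 : ℝ) T, ∀ ω i j, f t ω i j = X t.toNNReal ω i j := by
    intro t ht ω i j
    have : t.toNNReal ≤ T := Real.toNNReal_le_iff_le_coe.2 ht.2
    simp only [hf, Set.indicator_of_mem ht, min_eq_left this]
  -- `C η` will bound the error on the initial strip `(0, s]`, where the discretisation is 0, and
  -- `ε` the error on the grid cells; 4 counts the matrix entries.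
  obtain ⟨ε, hε, η, hη, hεη⟩ : ∃ ε : ℝ≥0∞, ε ≠ 0 ∧ ∃ η : ℝ, 0 < η ∧
      4 * (ENNReal.ofReal C * ENNReal.ofReal η + ε) ≤ κ := by
    have h0 : 0 < κ / 4 / 2 := ENNReal.div_pos (ENNReal.div_pos hκ (by simp)).ne' (by simp)
    have hlim : Tendsto (fun η : ℝ => ENNReal.ofReal C * ENNReal.ofReal η) (𝓝[>] 0) (𝓝 0) := by
      have h2 := ENNReal.Tendsto.const_mul (a := ENNReal.ofReal C)
        (ENNReal.tendsto_ofReal (tendsto_id (α := ℝ) (x := 𝓝 0))) (Or.inr (by simp))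
      simpa using h2.mono_left nhdsWithin_le_nhds
    obtain ⟨η, h1, h2⟩ := ((hlim.eventually_le_const h0).and self_mem_nhdsWithin).exists
    refine ⟨κ / 4 / 2, h0.ne', η, h2, ?_⟩
    calc 4 * (ENNReal.ofReal C * ENNReal.ofReal η + κ / 4 / 2)
        ≤ 4 * (κ / 4 / 2 + κ / 4 / 2) := by gcongr
      _ = κ := by rw [ENNReal.add_halves, ENNReal.mul_div_cancel (by simp) (by simp)]
  clear_value f
  obtain ⟨n, hn, δ, hδ, hnδ, hδη, s, hs, hsum⟩ :=
    exists_shifted_grid hfm hfi (T := T) (by exact_mod_cast hT) hη hε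
  have hleft0 : ∀ k : ℕ, 0 ≤ s + k * δ := fun k => by have := hs.1; positivity
  have hleftT : ∀ k < n, s + k * δ ≤ T := fun k hk => by
    have : (k : ℝ) + 1 ≤ n := by exact_mod_cast hk
    rw [← hnδ]
    nlinarith [hs.2]
  obtain ⟨K, hmeas, hcell', hzero⟩ := exists_discretisation hX hXC hδ hnδ hs
  have hcell : ∀ k < n, ∀ t ∈ Set.Ioc (s + k * δ) (s + (k + 1) * δ), ∀ ω i j,
      K.value t.toNNReal ω i j = f (s + k * δ) ω i j := fun k hk t ht ω i j => by
    rw [hcell' k hk t ht, hfX _ ⟨hleft0 k, hleftT k hk⟩]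
  have hcover : ∀ t ∈ Set.Ioc (0 : ℝ) T, t ∈ Set.Ioc 0 s ∨
      ∃ k < n, t ∈ Set.Ioc (s + k * δ) (s + (k + 1) * δ) := by
    intro t ht
    by_cases h : t ≤ s
    · exact Or.inl ⟨ht.1, h⟩
    · exact Or.inr (exists_mem_Ioc_grid ⟨not_le.1 h, by rw [hnδ]; linarith [ht.2, hs.1]⟩)
  refine ⟨K, fun t ht ω i j => ?_, hmeas, ?_⟩
  · rcases hcover t ht with h | ⟨k, hk, h⟩
    · rw [hzero t h, abs_zero]; exact hC
    · rw [hcell' k hk t h]; exact hXC _ _ _ _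
  have hpt : ∀ ω, ∀ t ∈ Set.Ioc (0 : ℝ) T,
      ∑ i, ∑ j, ‖K.value t.toNNReal ω i j - X t.toNNReal ω i j‖ₑ ≤
      4 * ((Set.Ioc 0 s).indicator (fun _ => ENNReal.ofReal C) t +
        ∑ k ∈ Finset.range n, (Set.Ioc (s + k * δ) (s + (k + 1) * δ)).indicator
          (fun t => ‖f t ω - f (s + k * δ) ω‖ₑ) t) := by
    intro ω t ht
    have hb : ∀ i j, ‖K.value t.toNNReal ω i j - X t.toNNReal ω i j‖ₑ ≤
        (Set.Ioc 0 s).indicator (fun _ => ENNReal.ofReal C) t +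
        ∑ k ∈ Finset.range n, (Set.Ioc (s + k * δ) (s + (k + 1) * δ)).indicator
          (fun t => ‖f t ω - f (s + k * δ) ω‖ₑ) t := by
      intro i j
      rcases hcover t ht with h | ⟨k, hk, h⟩
      · refine le_trans ?_ le_self_add
        rw [hzero t h, Set.indicator_of_mem h, zero_sub, enorm_neg, Real.enorm_eq_ofReal_abs]
        exact ENNReal.ofReal_le_ofReal (hXC _ _ _ _)
      · refine le_trans ?_ le_add_self
        refine le_trans ?_ (Finset.single_le_sum (f := fun k : ℕ =>
          (Set.Ioc (s + k * δ) (s + (k + 1) * δ)).indicator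
          (fun t => ‖f t ω - f (s + k * δ) ω‖ₑ) t) (fun _ _ => zero_le)
          (Finset.mem_range.2 hk))
        simp only [Set.indicator_of_mem h]
        rw [hcell k hk t h, ← hfX t ⟨ht.1.le, ht.2⟩, enorm_sub_rev, ← Pi.sub_apply,
          ← Pi.sub_apply]
        rw [enorm_le_iff_norm_le]
        exact (norm_le_pi_norm _ j).trans (norm_le_pi_norm (f t ω - f (s + k * δ) ω) i)
    refine (Finset.sum_le_sum fun i _ => Finset.sum_le_sum fun j _ => hb i j).trans ?_
    simp only [Finset.sum_const, Finset.card_univ, Fintype.card_fin, nsmul_eq_mul]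
    rw [← mul_assoc]
    norm_num
  have hterm : ∀ k : ℕ, Measurable fun p : Ω × ℝ => ‖f p.2 p.1 - f (s + k * δ) p.1‖ₑ := fun k =>
    ((hfm.comp_measurable (g := fun p : Ω × ℝ => (p.2, p.1)) (by fun_prop)).sub
      (hfm.comp_measurable (g := fun p : Ω × ℝ => (s + k * δ, p.1)) (by fun_prop))).enorm
  calc ∫⁻ ω, ∫⁻ t in Set.Ioc (0 : ℝ) T, ∑ i, ∑ j,
        ‖K.value t.toNNReal ω i j - X t.toNNReal ω i j‖ₑ ∂volume ∂Q
      ≤ ∫⁻ ω, 4 * (ENNReal.ofReal C * ENNReal.ofReal s + ∑ k ∈ Finset.range n,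
          ∫⁻ t in Set.Ioc (s + k * δ) (s + (k + 1) * δ), ‖f t ω - f (s + k * δ) ω‖ₑ) ∂Q := by
        refine lintegral_mono fun ω => ?_
        refine (setLIntegral_mono' measurableSet_Ioc (hpt ω)).trans ?_
        refine (setLIntegral_le_lintegral _ _).trans ?_
        have hmt : ∀ k : ℕ, Measurable fun t => ‖f t ω - f (s + k * δ) ω‖ₑ := fun k =>
          Measurable.comp (g := fun p : Ω × ℝ => ‖f p.2 p.1 - f (s + k * δ) p.1‖ₑ)
            (f := fun t => (ω, t)) (hterm k) measurable_prodMk_left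
        rw [lintegral_const_mul' _ _ (by simp), lintegral_add_left
          (measurable_const.indicator measurableSet_Ioc), lintegral_indicator measurableSet_Ioc,
          lintegral_finsetSum _ fun k _ => (hmt k).indicator measurableSet_Ioc]
        simp_rw [lintegral_indicator measurableSet_Ioc]
        simp
    _ = 4 * (ENNReal.ofReal C * ENNReal.ofReal s + ∑ k ∈ Finset.range n,
          ∫⁻ t in Set.Ioc (s + k * δ) (s + (k + 1) * δ),
            ∫⁻ ω, ‖f t ω - f (s + k * δ) ω‖ₑ ∂Q) := by
        rw [lintegral_const_mul' _ _ (by simp), lintegral_add_left measurable_const,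
          lintegral_finsetSum _ fun k _ => (hterm k).lintegral_prod_right']
        simp only [lintegral_const, measure_univ, mul_one]
        congr 3
        ext k
        exact lintegral_lintegral_swap (hterm k).aemeasurable
    _ ≤ 4 * (ENNReal.ofReal C * ENNReal.ofReal η + ε) := by
        gcongr
        exact hs.2.trans hδη
    _ ≤ κ := hεη

end ElementaryProcess

end StochCov

/-! ### Truncation and approximation of square integrable processes -/

namespace StochCov

variable {Ω : Type*} {mΩ : MeasurableSpace Ω} {ℱ : Filtration ℝ≥0 mΩ} {Q : Measure Ω} {T : ℝ≥0}
  {H : ℝ≥0 → Ω → Mat}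

/-- The integrated squared distance `∫₀ᵀ ‖a_s - b_s‖² ds` of two matrix-valued paths. -/
noncomputable def sqDist (T : ℝ≥0) (a b : ℝ≥0 → Mat) : ℝ :=
  ∫ s in (0 : ℝ)..T, ∑ i, ∑ j, (a s.toNNReal i j - b s.toNNReal i j) ^ 2

/-- A matrix-valued path that is square integrable on `[0, T]`. -/
def SqIntegrable (T : ℝ≥0) (a : ℝ≥0 → Mat) : Prop :=
  ∀ i j, MemLp (fun s : ℝ => a s.toNNReal i j) 2 (volume.restrict (Set.Ioc (0 : ℝ) T))

theorem integral_zero_coe (f : ℝ → ℝ) (T : ℝ≥0) :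
    ∫ s in (0 : ℝ)..T, f s = ∫ s in Set.Ioc (0 : ℝ) T, f s :=
  intervalIntegral.integral_of_le T.2

theorem toNNReal_le_of_mem {s : ℝ} (hs : s ∈ Set.Ioc (0 : ℝ) T) : s.toNNReal ≤ T :=
  Real.toNNReal_le_iff_le_coe.2 hs.2

theorem SqIntegrable.integrable_sq_sub {a b : ℝ≥0 → Mat} (ha : SqIntegrable T a)
    (hb : SqIntegrable T b) : Integrable
      (fun s : ℝ => ∑ i, ∑ j, (a s.toNNReal i j - b s.toNNReal i j) ^ 2)
      (volume.restrict (Set.Ioc (0 : ℝ) T)) :=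
  integrable_finsetSum _ fun i _ => integrable_finsetSum _ fun j _ =>
    ((ha i j).sub (hb i j)).integrable_sq

theorem sqDist_comm (a b : ℝ≥0 → Mat) : sqDist T a b = sqDist T b a := by
  simp only [sqDist]
  refine intervalIntegral.integral_congr fun s _ => ?_
  exact Finset.sum_congr rfl fun i _ => Finset.sum_congr rfl fun j _ => by ring

theorem sqDist_nonneg (a b : ℝ≥0 → Mat) : 0 ≤ sqDist T a b :=
  intervalIntegral.integral_nonneg T.2 fun _ _ =>
    Finset.sum_nonneg fun _ _ => Finset.sum_nonneg fun _ _ => sq_nonneg _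

/-- Pointwise this is `(x + y)² ≤ 2x² + 2y²`. Square integrability matters because a divergent
integral on the right would count as 0. -/
theorem sqDist_triangle {a b c : ℝ≥0 → Mat} (ha : SqIntegrable T a) (hb : SqIntegrable T b)
    (hc : SqIntegrable T c) : sqDist T a c ≤ 2 * sqDist T a b + 2 * sqDist T b c := by
  simp only [sqDist, integral_zero_coe]
  rw [← integral_const_mul, ← integral_const_mul, ← integral_add
    ((ha.integrable_sq_sub hb).const_mul 2) ((hb.integrable_sq_sub hc).const_mul 2)]
  refine integral_mono (ha.integrable_sq_sub hc)
    (((ha.integrable_sq_sub hb).const_mul 2).add ((hb.integrable_sq_sub hc).const_mul 2))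
    fun s => ?_
  simp only [Finset.mul_sum]
  rw [← Finset.sum_add_distrib]
  refine Finset.sum_le_sum fun i _ => ?_
  rw [← Finset.sum_add_distrib]
  refine Finset.sum_le_sum fun j _ => ?_
  nlinarith [sq_nonneg (a s.toNNReal i j - b s.toNNReal i j
    - (b s.toNNReal i j - c s.toNNReal i j))]

theorem measurable_path {x : ℝ≥0 → Ω → ℝ} (hx : IsStronglyProgressive ℱ x) (T : ℝ≥0) (ω : Ω) :
    AEStronglyMeasurable (fun s : ℝ => x s.toNNReal ω)
      (volume.restrict (Set.Ioc (0 : ℝ) T)) := by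
  have h1 : Measurable fun s : ℝ => x (min s.toNNReal T) ω :=
    Measurable.comp (f := fun s : ℝ => (s, ω)) (measurable_uncurry_min hx T)
      measurable_prodMk_right
  refine h1.aestronglyMeasurable.congr ?_
  filter_upwards [ae_restrict_mem measurableSet_Ioc] with s hs
  rw [min_eq_left (toNNReal_le_of_mem hs)]

theorem SqIntegrable.of_bounded {a : ℝ≥0 → Mat} {C : ℝ}
    (hm : ∀ i j, AEStronglyMeasurable (fun s : ℝ => a s.toNNReal i j)
      (volume.restrict (Set.Ioc (0 : ℝ) T))) (hC : ∀ t i j, |a t i j| ≤ C) :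
    SqIntegrable T a := fun i j =>
  (memLp_top_of_bound (hm i j) C (.of_forall fun _ => hC _ i j)).mono_exponent le_top

theorem ElementaryProcess.sqIntegrable_value (G : ElementaryProcess ℱ) (T : ℝ≥0) (ω : Ω) :
    SqIntegrable T fun t => G.value t ω := by
  obtain ⟨C, hC⟩ := G.exists_bound_value
  refine SqIntegrable.of_bounded (fun i j => ?_) fun t i j => hC t ω i j
  exact (Measurable.comp (f := fun s : ℝ => (s, ω)) (G.measurable_uncurry_value i j)
      measurable_prodMk_right).aestronglyMeasurable

theorem ae_sqIntegrable (hH : ∀ i j, IsStronglyProgressive ℱ fun t ω => H t ω i j)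
    (hsq : ∀ᵐ ω ∂Q, ∀ i j,
      IntervalIntegrable (fun s : ℝ => (H s.toNNReal ω i j) ^ 2) volume 0 T) :
    ∀ᵐ ω ∂Q, SqIntegrable T fun t => H t ω := by
  filter_upwards [hsq] with ω hω i j
  rw [memLp_two_iff_integrable_sq (measurable_path (hH i j) T ω)]
  exact (intervalIntegrable_iff_integrableOn_Ioc_of_le T.2).1 (hω i j)

theorem measurable_integral_path {g : ℝ → Ω → ℝ}
    {g' : ℝ → Ω → ℝ} (hg' : Measurable (Function.uncurry g'))
    (h : ∀ s ∈ Set.Ioc (0 : ℝ) T, ∀ ω, g s ω = g' s ω) :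
    Measurable fun ω => ∫ s in Set.Ioc (0 : ℝ) T, g s ω := by
  have : (fun ω => ∫ s in Set.Ioc (0 : ℝ) T, g s ω) = fun ω => ∫ s in Set.Ioc (0 : ℝ) T, g' s ω :=
    funext fun ω => setIntegral_congr_fun measurableSet_Ioc fun s hs => h s hs ω
  rw [this]
  exact (hg'.stronglyMeasurable.integral_prod_left
    (μ := volume.restrict (Set.Ioc (0 : ℝ) T))).measurable

/-- Truncation of a real number at level `N`. -/
noncomputable def clip (N : ℝ) (x : ℝ) : ℝ := max (-N) (min x N)

theorem continuous_clip (N : ℝ) : Continuous (clip N) := by unfold clip; fun_prop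

theorem abs_clip_le {N : ℝ} (hN : 0 ≤ N) (x : ℝ) : |clip N x| ≤ N := by
  rw [abs_le]
  exact ⟨le_max_left _ _, max_le (by linarith) (min_le_right _ _)⟩

theorem clip_eq_self {N x : ℝ} (h : |x| ≤ N) : clip N x = x := by
  rw [abs_le] at h
  rw [clip, min_eq_left h.2, max_eq_right h.1]

theorem sq_clip_sub_le {N : ℝ} (hN : 0 ≤ N) (x : ℝ) : (clip N x - x) ^ 2 ≤ x ^ 2 := by
  unfold clip
  rcases le_total x N with h | h
  · rw [min_eq_left h]
    rcases le_total (-N) x with h' | h'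
    · rw [max_eq_right h']; nlinarith [sq_nonneg x]
    · rw [max_eq_left h']; nlinarith
  · rw [min_eq_right h, max_eq_right (by linarith)]; nlinarith

/-- The process `H` truncated entrywise at level `N`. -/
noncomputable def clipProcess (N : ℝ) (H : ℝ≥0 → Ω → Mat) (t : ℝ≥0) (ω : Ω) : Mat :=
  Matrix.of fun i j => clip N (H t ω i j)

/-- Clipping acts entry by entry at each time, so an approximation built from the clipped path is
still a function of the path of `H`. -/
theorem pathAlgebra_clip_le (N : ℝ) (H : ℝ≥0 → Ω → Mat) (T : ℝ≥0) :
    pathAlgebra (clipProcess N H) T ≤ pathAlgebra H T :=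
  Measurable.comap_le (measurable_covPath (m := pathAlgebra H T) fun _ ht i j =>
    (continuous_clip N).measurable.comp (measurable_pathAlgebra_entry H ht i j))

theorem progressive_clip (hH : ∀ i j, IsStronglyProgressive ℱ fun t ω => H t ω i j) (N : ℝ)
    (i j : Fin 2) : IsStronglyProgressive ℱ fun t ω => clipProcess N H t ω i j := fun t =>
  (continuous_clip N).comp_stronglyMeasurable (hH i j t)

theorem tendstoInMeasure_sqDist_clip [IsFiniteMeasure Q]
    (hH : ∀ i j, IsStronglyProgressive ℱ fun t ω => H t ω i j)
    (hsq : ∀ᵐ ω ∂Q, SqIntegrable T fun t => H t ω) :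
    TendstoInMeasure Q (fun (n : ℕ) ω => sqDist T (fun t => clipProcess n H t ω) fun t => H t ω)
      atTop fun _ => 0 := by
  simp only [sqDist, integral_zero_coe]
  refine tendstoInMeasure_of_tendsto_ae (fun n => ?_) ?_
  · refine Measurable.aestronglyMeasurable (measurable_integral_path (g' := fun s ω =>
      ∑ i, ∑ j, (clip n (H (min s.toNNReal T) ω i j) - H (min s.toNNReal T) ω i j) ^ 2) ?_ ?_)
    · refine Finset.measurable_sum _ fun i _ => Finset.measurable_sum _ fun j _ => ?_
      have h1 := measurable_uncurry_min (hH i j) T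
      exact (((continuous_clip n).measurable.comp h1).sub h1).pow_const 2
    · intro s hs ω
      rw [min_eq_left (toNNReal_le_of_mem hs)]
      rfl
  · filter_upwards [hsq] with ω hω
    have hlim := tendsto_integral_of_dominated_convergence
      (μ := volume.restrict (Set.Ioc (0 : ℝ) T))
      (F := fun (n : ℕ) (s : ℝ) => ∑ i, ∑ j,
        (clipProcess n H s.toNNReal ω i j - H s.toNNReal ω i j) ^ 2) (f := fun _ => (0 : ℝ))
      (fun s : ℝ => ∑ i, ∑ j, H s.toNNReal ω i j ^ 2) (fun n => ?_) ?_ (fun n => ?_) ?_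
    · simpa using hlim
    · refine Finset.aestronglyMeasurable_fun_sum _ fun i _ =>
        Finset.aestronglyMeasurable_fun_sum _ fun j _ => ?_
      have h1 := measurable_path (hH i j) T ω
      exact (((continuous_clip n).comp_aestronglyMeasurable h1).sub h1).pow 2
    · exact integrable_finsetSum _ fun i _ => integrable_finsetSum _ fun j _ =>
        (hω i j).integrable_sq
    · refine .of_forall fun s => ?_
      rw [Real.norm_of_nonneg (Finset.sum_nonneg fun i _ => Finset.sum_nonneg fun j _ =>
        sq_nonneg _)]
      exact Finset.sum_le_sum fun i _ => Finset.sum_le_sum fun j _ =>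
        sq_clip_sub_le n.cast_nonneg _
    · refine .of_forall fun s => ?_
      have : Tendsto (fun n : ℕ => ∑ i, ∑ j,
          (clipProcess n H s.toNNReal ω i j - H s.toNNReal ω i j) ^ 2) atTop
          (𝓝 (∑ _i : Fin 2, ∑ _j : Fin 2, 0)) := by
        refine tendsto_finsetSum _ fun i _ => tendsto_finsetSum _ fun j _ => ?_
        refine tendsto_const_nhds.congr' ?_
        obtain ⟨m, hm⟩ := exists_nat_ge |H s.toNNReal ω i j|
        filter_upwards [eventually_ge_atTop m] with n hn
        have : |H s.toNNReal ω i j| ≤ n := hm.trans (by exact_mod_cast hn)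
        simp [clipProcess, clip_eq_self this]
      simpa using this

theorem exists_elementary_sqDist_bounded [IsProbabilityMeasure Q] {X : ℝ≥0 → Ω → Mat}
    (hX : ∀ i j, IsStronglyProgressive ℱ fun t ω => X t ω i j) {C : ℝ} (hC : 0 < C)
    (hXC : ∀ t ω i j, |X t ω i j| ≤ C) (hT : 0 < T) {ρ : ℝ} (hρ : 0 < ρ)
    {κ : ℝ≥0∞} (hκ : κ ≠ 0) :
    ∃ K : ElementaryProcess ℱ,
      (∀ t i j, Measurable[pathAlgebra X T] fun ω => K.value t ω i j) ∧
      Q {ω | ρ ≤ sqDist T (fun t => K.value t ω) fun t => X t ω} ≤ κ := by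
  have hc0 : ENNReal.ofReal (ρ / (2 * C)) ≠ 0 := by simp; positivity
  obtain ⟨K, hKC, hKm, hK⟩ := ElementaryProcess.exists_approx_of_bounded (Q := Q) hX hC.le hXC hT
    (κ := κ * ENNReal.ofReal (ρ / (2 * C))) (mul_ne_zero hκ hc0)
  refine ⟨K, hKm, ?_⟩
  set A : Ω → ℝ≥0∞ := fun ω => ∫⁻ t in Set.Ioc (0 : ℝ) T, ∑ i, ∑ j,
        ‖K.value t.toNNReal ω i j - X t.toNNReal ω i j‖ₑ with hA
  have hAm : Measurable A := by
    have : A = fun ω => ∫⁻ t in Set.Ioc (0 : ℝ) T, ∑ i, ∑ j,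
        ‖K.value t.toNNReal ω i j - X (min t.toNNReal T) ω i j‖ₑ := by
      ext ω
      refine setLIntegral_congr_fun measurableSet_Ioc fun s hs => ?_
      simp only [min_eq_left (toNNReal_le_of_mem hs)]
    rw [this]
    refine Measurable.lintegral_prod_left' (f := fun p : ℝ × Ω => ∑ i, ∑ j,
        ‖K.value p.1.toNNReal p.2 i j - X (min p.1.toNNReal T) p.2 i j‖ₑ) ?_
    exact Finset.measurable_sum _ fun i _ => Finset.measurable_sum _ fun j _ =>
      ((K.measurable_uncurry_value i j).sub (measurable_uncurry_min (hX i j) T)).enorm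
  -- Both processes are bounded by `C` on `(0, T]`, so `(x - y)² ≤ 2C |x - y|`. The `L¹` estimate
  -- therefore controls the squared distance, and Markov's inequality at level `ρ / (2C)` finishes.
  have hbd : ∀ ω, ENNReal.ofReal (sqDist T (fun t => K.value t ω) fun t => X t ω)
      ≤ ENNReal.ofReal (2 * C) * A ω := by
    intro ω
    refine (ENNReal.ofReal_le_ofReal (le_abs_self _)).trans ?_
    rw [← Real.enorm_eq_ofReal_abs, sqDist, integral_zero_coe]
    refine (enorm_integral_le_lintegral_enorm _).trans ?_
    rw [hA, ← lintegral_const_mul' _ _ ENNReal.ofReal_ne_top]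
    refine setLIntegral_mono' measurableSet_Ioc fun s hs => ?_
    rw [Finset.mul_sum]
    refine (enorm_sum_le _ _).trans (Finset.sum_le_sum fun i _ => ?_)
    rw [Finset.mul_sum]
    refine (enorm_sum_le _ _).trans (Finset.sum_le_sum fun j _ => ?_)
    rw [pow_two, enorm_mul]
    gcongr
    rw [Real.enorm_eq_ofReal_abs]
    refine ENNReal.ofReal_le_ofReal ((abs_sub _ _).trans ?_)
    linarith [hKC s hs ω i j, hXC s.toNNReal ω i j]
  have hsub : {ω | ρ ≤ sqDist T (fun t => K.value t ω) fun t => X t ω} ⊆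
      {ω | ENNReal.ofReal (ρ / (2 * C)) ≤ A ω} := by
    intro ω hω
    have h1 : ENNReal.ofReal ρ ≤ ENNReal.ofReal (2 * C) * A ω :=
      (ENNReal.ofReal_le_ofReal hω).trans (hbd ω)
    show ENNReal.ofReal (ρ / (2 * C)) ≤ A ω
    rw [ENNReal.ofReal_div_of_pos (by positivity)]
    exact ENNReal.div_le_of_le_mul' h1
  refine (measure_mono hsub).trans ((meas_ge_le_lintegral_div hAm.aemeasurable hc0 (by simp)).trans ?_)
  exact ENNReal.div_le_of_le_mul hK

/-- Truncate first, then discretise; the factors 2 in `sqDist_triangle` turn two errors below `ρ /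
4` into one below `ρ`. -/
theorem exists_elementary_sqDist [IsProbabilityMeasure Q]
    (hH : ∀ i j, IsStronglyProgressive ℱ fun t ω => H t ω i j)
    (hsq : ∀ᵐ ω ∂Q, SqIntegrable T fun t => H t ω) {ρ : ℝ} (hρ : 0 < ρ)
    {κ : ℝ≥0∞} (hκ : κ ≠ 0) :
    ∃ K : ElementaryProcess ℱ,
      (∀ t i j, Measurable[pathAlgebra H T] fun ω => K.value t ω i j) ∧
      Q {ω | ρ ≤ sqDist T (fun t => K.value t ω) fun t => H t ω} ≤ κ := by
  rcases eq_or_lt_of_le (zero_le (a := T)) with hT | hT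
  -- For `T = 0` there is nothing to discretise: the empty sum serves, as integrals from 0 to 0
  -- vanish.
  · refine ⟨⟨0, Fin.elim0, Fin.elim0, Fin.elim0, fun k => k.elim0, fun k => k.elim0,
      ⟨0, fun k => k.elim0⟩⟩, fun t i j => ?_, ?_⟩
    · simp_rw [ElementaryProcess.value_apply]
      exact Finset.measurable_sum _ fun k => k.elim0
    · simp [sqDist, ← hT, hρ.not_ge]
  have hclip := tendstoInMeasure_iff_norm.1 (tendstoInMeasure_sqDist_clip hH hsq) (ρ / 4)
    (by positivity)
  obtain ⟨n, hn, hn1⟩ := ((hclip.eventually_le_const (ENNReal.half_pos hκ)).and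
    (eventually_ge_atTop 1)).exists
  have hn0 : (0 : ℝ) < n := by exact_mod_cast hn1
  obtain ⟨K, hKm, hK⟩ := exists_elementary_sqDist_bounded (Q := Q) (progressive_clip hH n) hn0
    (fun t ω i j => abs_clip_le hn0.le _) hT (ρ := ρ / 4) (by positivity)
    (ENNReal.half_pos hκ).ne'
  refine ⟨K, fun t i j => (hKm t i j).mono (pathAlgebra_clip_le _ _ _) le_rfl, ?_⟩
  refine (measure_mono_ae (t := {ω | ρ / 4 ≤ ‖sqDist T (fun t => clipProcess n H t ω)
    (fun t => H t ω) - 0‖} ∪ {ω | ρ / 4 ≤ sqDist T (fun t => K.value t ω)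
      fun t => clipProcess n H t ω}) ?_).trans ?_
  · filter_upwards [hsq] with ω hω (h : ρ ≤ _)
    have hX : SqIntegrable T fun t => clipProcess n H t ω :=
      SqIntegrable.of_bounded (fun i j => measurable_path (progressive_clip hH n i j) T ω)
        fun t i j => abs_clip_le hn0.le _
    have h3 := sqDist_triangle (K.sqIntegrable_value T ω) hX hω
    by_contra hcon
    have h4 : ¬ ρ / 4 ≤ ‖sqDist T (fun t => clipProcess n H t ω) (fun t => H t ω) - 0‖ :=
      fun h => hcon (Or.inl h)
    have h5 : ¬ ρ / 4 ≤ sqDist T (fun t => K.value t ω) fun t => clipProcess n H t ω :=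
      fun h => hcon (Or.inr h)
    rw [sub_zero, Real.norm_of_nonneg (sqDist_nonneg _ _)] at h4
    linarith
  · exact (measure_union_le _ _).trans ((add_le_add hn hK).trans (ENNReal.add_halves κ).le)

/-- A progressive process with square integrable paths is approximated by elementary processes
that are functions of its own path. -/
theorem exists_seq_elementary [IsProbabilityMeasure Q]
    (hH : ∀ i j, IsStronglyProgressive ℱ fun t ω => H t ω i j)
    (hsq : ∀ᵐ ω ∂Q, SqIntegrable T fun t => H t ω) :
    ∃ K : ℕ → ElementaryProcess ℱ,
      (∀ n t i j, Measurable[pathAlgebra H T] fun ω => (K n).value t ω i j) ∧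
      TendstoInMeasure Q (fun n ω => sqDist T (fun t => (K n).value t ω) fun t => H t ω) atTop
        fun _ => 0 := by
  choose K hKm hK using fun n : ℕ => exists_elementary_sqDist (Q := Q) hH hsq
    (ρ := 1 / ((n : ℝ) + 1)) (by positivity) (κ := ENNReal.ofReal (1 / ((n : ℝ) + 1)))
    (by simp; positivity)
  refine ⟨K, hKm, tendstoInMeasure_iff_norm.2 fun ε hε => ?_⟩
  have h0 : Tendsto (fun n : ℕ => 1 / ((n : ℝ) + 1)) atTop (𝓝 0) :=
    tendsto_one_div_add_atTop_nhds_zero_nat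
  have h1 : Tendsto (fun n : ℕ => ENNReal.ofReal (1 / ((n : ℝ) + 1))) atTop (𝓝 0) := by
    simpa using ENNReal.tendsto_ofReal h0
  refine tendsto_of_tendsto_of_tendsto_of_le_of_le' tendsto_const_nhds h1
    (.of_forall fun _ => zero_le) ?_
  filter_upwards [h0.eventually_le_const hε] with n hn
  refine le_trans (measure_mono fun ω hω => ?_) (hK n)
  have hω' : ε ≤ ‖sqDist T (fun t => (K n).value t ω) (fun t => H t ω) - 0‖ := hω
  rw [sub_zero, Real.norm_of_nonneg (sqDist_nonneg _ _)] at hω'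
  exact hn.trans hω'

/-- The difference of the integrals of two elementary approximations of the same process tends
to zero in probability. -/
theorem tendstoInMeasure_integral_sub [IsProbabilityMeasure Q] {B : ℝ≥0 → Ω → Plane}
    (hB : IsPlanarBrownian ℱ Q B) (hsq : ∀ᵐ ω ∂Q, SqIntegrable T fun t => H t ω)
    {K G : ℕ → ElementaryProcess ℱ}
    (hK : TendstoInMeasure Q (fun n ω => sqDist T (fun t => (K n).value t ω) fun t => H t ω) atTop
        fun _ => 0)
    (hG : TendstoInMeasure Q (fun n ω => sqDist T (fun t => (G n).value t ω) fun t => H t ω) atTop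
        fun _ => 0) :
    TendstoInMeasure Q (fun n ω => (K n).integral B T ω - (G n).integral B T ω) atTop
      fun _ => 0 := by
  simp_rw [← ElementaryProcess.integral_sub]
  refine ElementaryProcess.tendstoInMeasure_integral hB ?_
  simp_rw [ElementaryProcess.value_sub]
  change TendstoInMeasure Q (fun n ω => sqDist T (fun t => (K n).value t ω)
    fun t => (G n).value t ω) atTop _
  rw [tendstoInMeasure_iff_norm] at hK hG ⊢
  intro ε hε
  have h1 := (hK (ε / 4) (by positivity)).add (hG (ε / 4) (by positivity))
  rw [add_zero] at h1
  refine tendsto_of_tendsto_of_tendsto_of_le_of_le tendsto_const_nhds h1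
    (fun _ => zero_le) fun n => ?_
  refine le_trans (measure_mono_ae ?_) (measure_union_le _ _)
  filter_upwards [hsq] with ω hω (h : ε ≤ _)
  have h3 := sqDist_triangle ((K n).sqIntegrable_value T ω) hω ((G n).sqIntegrable_value T ω)
  rw [sqDist_comm (fun t => H t ω)] at h3
  by_contra hcon
  have h4 : ¬ ε / 4 ≤ ‖sqDist T (fun t => (K n).value t ω) (fun t => H t ω) - 0‖ :=
    fun h => hcon (Or.inl h)
  have h5 : ¬ ε / 4 ≤ ‖sqDist T (fun t => (G n).value t ω) (fun t => H t ω) - 0‖ :=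
    fun h => hcon (Or.inr h)
  rw [sub_zero, Real.norm_of_nonneg (sqDist_nonneg _ _)] at h h4 h5
  linarith

end StochCov

/-! ### Conditional Gaussianity for elementary integrands -/

namespace StochCov

variable {Ω : Type*} {mΩ : MeasurableSpace Ω} {ℱ : Filtration ℝ≥0 mΩ} {Q : Measure Ω} {T : ℝ≥0}
  {H : ℝ≥0 → Ω → Mat} {B : ℝ≥0 → Ω → Plane}

theorem IsFilteredBrownian.integral_cexp_sub {b : ℝ≥0 → Ω → ℝ} (hb : IsFilteredBrownian ℱ Q b)
    {s t : ℝ≥0} (hst : s ≤ t) (c : ℝ) :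
    ∫ ω, Complex.exp (Complex.I * (c * (b t ω - b s ω) : ℝ)) ∂Q
      = Complex.exp ((-(1 / 2) * (c ^ 2 * ((t : ℝ) - s)) : ℝ)) := by
  have h := hb.hasLaw_sub hst
  have h1 := charFun_gaussianReal (μ := 0) (v := t - s) c
  rw [← h.map_eq, charFun_apply_real, integral_map h.aemeasurable (by fun_prop)] at h1
  convert h1 using 1
  · refine integral_congr_ae (.of_forall fun ω => ?_)
    simp only
    congr 1
    push_cast
    ring
  · congr 1
    rw [NNReal.coe_sub hst]
    push_cast
    ring

namespace IsPlanarBrownian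

theorem measurable (hB : IsPlanarBrownian ℱ Q B) (t : ℝ≥0) : Measurable (B t) :=
  (hB.adapted t).mono (ℱ.le t) le_rfl

theorem integral_cexp_sub (hB : IsPlanarBrownian ℱ Q B) {s t : ℝ≥0} (hst : s ≤ t)
    (c : Fin 2 → ℝ) :
    ∫ ω, Complex.exp (Complex.I * (∑ j, c j * (B t ω j - B s ω j) : ℝ)) ∂Q
      = Complex.exp ((-(1 / 2) * ∑ j, c j ^ 2 * ((t : ℝ) - s) : ℝ)) := by
  have hg : ∀ a : ℝ, Measurable fun x : ℝ => Complex.exp (Complex.I * (a * x : ℝ)) :=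
    fun a => by fun_prop
  have hsub : Measurable fun x : ℝ≥0 → ℝ => x t - x s := by fun_prop
  have h01 := hB.indep_components.indepFun (i := 0) (j := 1) (by decide)
  have hind := h01.comp ((hg (c 0)).comp hsub) ((hg (c 1)).comp hsub)
  have hm : ∀ j, Measurable fun ω => B t ω j - B s ω j := fun j =>
    ((hB.isFilteredBrownian j).measurable t).sub ((hB.isFilteredBrownian j).measurable s)
  have hmul := hind.integral_fun_mul_eq_mul_integral
    ((hg (c 0)).comp (hm 0)).aestronglyMeasurable ((hg (c 1)).comp (hm 1)).aestronglyMeasurable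
  simp only [Function.comp_apply] at hmul
  rw [(hB.isFilteredBrownian 0).integral_cexp_sub hst,
    (hB.isFilteredBrownian 1).integral_cexp_sub hst] at hmul
  simp_rw [← Complex.exp_add, ← mul_add, ← Complex.ofReal_add, ← mul_add] at hmul
  simp only [Fin.sum_univ_two]
  exact hmul

/-- The characteristic function of a deterministic linear combination of successive increments. -/
theorem integral_cexp_sum (hB : IsPlanarBrownian ℱ Q B) {τ : ℕ → ℝ≥0} (hτ : Monotone τ)
    [IsProbabilityMeasure Q] (c : ℕ → Fin 2 → ℝ) (n : ℕ) :
    ∫ ω, Complex.exp (Complex.I * (∑ k ∈ Finset.range n, ∑ j, c k j *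
        (B (τ (k + 1)) ω j - B (τ k) ω j) : ℝ)) ∂Q
      = Complex.exp ((-(1 / 2) * ∑ k ∈ Finset.range n, ∑ j, c k j ^ 2 *
        ((τ (k + 1) : ℝ) - τ k) : ℝ)) := by
  induction n with
  | zero => simp
  | succ n ih =>
    set P : Ω → ℝ := fun ω => ∑ k ∈ Finset.range n, ∑ j, c k j *
        (B (τ (k + 1)) ω j - B (τ k) ω j) with hP
    have hPm : Measurable[ℱ (τ n)] P := by
      refine Finset.measurable_sum _ fun k hk => Finset.measurable_sum _ fun j _ => ?_
      have hk' : k + 1 ≤ n := Finset.mem_range.1 hk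
      have h1 := ((hB.isFilteredBrownian j).adapted (τ (k + 1))).mono (ℱ.mono (hτ hk')) le_rfl
      have h2 := ((hB.isFilteredBrownian j).adapted (τ k)).mono
        (ℱ.mono (hτ (k.le_succ.trans hk'))) le_rfl
      exact (h1.sub h2).const_mul _
    have hle : τ n ≤ τ (n + 1) := hτ n.le_succ
    have hΔm : Measurable fun ω => B (τ (n + 1)) ω - B (τ n) ω :=
      (hB.measurable _).sub (hB.measurable _)
    have hind : IndepFun P (fun ω => B (τ (n + 1)) ω - B (τ n) ω) Q := by
      rw [IndepFun_iff_Indep]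
      exact indep_of_indep_of_le_left (hB.indep_increments _ _ hle).symm hPm.comap_le
    have hind2 := hind.comp (φ := fun x : ℝ => Complex.exp (Complex.I * x))
      (ψ := fun x : Plane => Complex.exp (Complex.I * (∑ j, c n j * x j : ℝ)))
      (by fun_prop) (by fun_prop)
    have hP' : Measurable P := hPm.mono (ℱ.le _) le_rfl
    have hmul := hind2.integral_fun_mul_eq_mul_integral
      (Measurable.aestronglyMeasurable (by fun_prop))
      (Measurable.aestronglyMeasurable (by fun_prop))
    simp only [Function.comp_apply, PiLp.sub_apply] at hmul
    rw [ih, hB.integral_cexp_sub hle, ← Complex.exp_add] at hmul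
    convert hmul using 1
    · refine integral_congr_ae (.of_forall fun ω => ?_)
      simp only [Finset.sum_range_succ, ← Complex.exp_add, hP]
      congr 1
      push_cast
      ring
    · congr 1
      simp only [Finset.sum_range_succ]
      push_cast
      ring

end IsPlanarBrownian

/-- The quadratic form `|aᵀ u|²`. -/
def rowQuad (u : Plane) (a : Mat) : ℝ := ∑ j, (∑ i, u i * a i j) ^ 2

theorem pathAlgebra_le (hH : ∀ i j, IsStronglyProgressive ℱ fun t ω => H t ω i j) (T : ℝ≥0) :
    pathAlgebra H T ≤ mΩ :=
  (measurable_covPath fun t _ i j =>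
    ((hH i j).stronglyAdapted t).measurable.mono (ℱ.le t) le_rfl).comap_le

/-- If the integrand is a function of a process that is independent of the Brownian motion, then
the elementary integral is conditionally Gaussian. -/
theorem integral_mul_cexp_elementary [IsProbabilityMeasure Q] (hB : IsPlanarBrownian ℱ Q B)
    (hH : ∀ i j, IsStronglyProgressive ℱ fun t ω => H t ω i j)
    (hind : IndepFun (covPath H T) (fun ω (t : Set.Iic T) => B t ω) Q)
    {K : ElementaryProcess ℱ} (hK : ∀ t i j, Measurable[pathAlgebra H T] fun ω => K.value t ω i j)
    {Z : Ω → ℂ} (hZ : Measurable[pathAlgebra H T] Z) {C : ℝ} (hC : ∀ ω, ‖Z ω‖ ≤ C) (u : Plane) :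
    ∫ ω, Z ω * Complex.exp (Complex.I * (∑ i, u i * K.integral B T ω i : ℝ)) ∂Q
      = ∫ ω, Z ω * Complex.exp ((-(1 / 2) *
          ∫ s in (0 : ℝ)..T, rowQuad u (K.value s.toNNReal ω) : ℝ)) ∂Q := by
  obtain ⟨N, τ, h⟩ := K.exists_isGrid T
  have hX : Measurable (covPath H T) := measurable_covPath fun t _ i j =>
    ((hH i j).stronglyAdapted t).measurable.mono (ℱ.le t) le_rfl
  have hW : Measurable fun ω (t : Set.Iic T) => B t ω :=
    measurable_pi_lambda _ fun t => hB.measurable t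
  have hc : ∀ k j, Measurable[pathAlgebra H T] fun ω => ∑ i, u i * K.value (τ (k + 1)) ω i j :=
    fun k j => Finset.measurable_sum _ fun i _ => (hK _ i j).const_mul _
  -- Doob–Dynkin: the weight and the coefficients factor through the path of `H`. Since that path is
  -- independent of `B`, the joint law is a product, and Fubini lets the coefficients be frozen.
  obtain ⟨ζ, hζm, hζ⟩ := hZ.exists_eq_measurable_comp
  choose γ hγm hγ using fun k j => (hc k j).exists_eq_measurable_comp
  have hγ' : ∀ k j ω, ∑ i, u i * K.value (τ (k + 1)) ω i j = γ k j (covPath H T ω) :=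
    fun k j ω => congrFun (hγ k j) ω
  have hζ' : ∀ ω, Z ω = ζ (covPath H T ω) := fun ω => congrFun hζ ω
  have e1 : ∀ ω, ∑ i, u i * K.integral B T ω i = ∑ k ∈ Finset.range N, ∑ j,
      γ k j (covPath H T ω) * (B (τ (k + 1)) ω j - B (τ k) ω j) := by
    intro ω
    simp only [h.integral_eq, transform, ← hγ', Fin.sum_univ_two, add_mul]
    simp only [Finset.sum_add_distrib, mul_add, Finset.mul_sum, mul_assoc]
    ring
  have e2 : ∀ ω, ∫ s in (0 : ℝ)..T, rowQuad u (K.value s.toNNReal ω) = ∑ k ∈ Finset.range N, ∑ j,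
      γ k j (covPath H T ω) ^ 2 * ((τ (k + 1) : ℝ) - τ k) := by
    intro ω
    rw [(h.integral_comp_value (rowQuad u) ω).2]
    simp only [rowQuad, hγ', Finset.sum_mul]
  set F : (Set.Iic T → Fin 2 → Fin 2 → ℝ) × (Set.Iic T → Plane) → ℂ := fun p =>
    ζ p.1 * Complex.exp (Complex.I * (∑ k ∈ Finset.range N, ∑ j,
      γ k j p.1 * (p.2 ⟨τ (k + 1), h.le _⟩ j - p.2 ⟨τ k, h.le _⟩ j) : ℝ)) with hF
  have hFm : Measurable F := by
    have hw : ∀ (t : Set.Iic T) (j : Fin 2), Measurable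
        fun p : (Set.Iic T → Fin 2 → Fin 2 → ℝ) × (Set.Iic T → Plane) => p.2 t j := by
      intro t j; fun_prop
    have hg : ∀ k j, Measurable
        fun p : (Set.Iic T → Fin 2 → Fin 2 → ℝ) × (Set.Iic T → Plane) => γ k j p.1 :=
      fun k j => (hγm k j).comp measurable_fst
    refine (hζm.comp measurable_fst).mul (Complex.measurable_exp.comp (Measurable.const_mul
      (Complex.measurable_ofReal.comp ?_) _))
    exact Finset.measurable_sum _ fun k _ => Finset.measurable_sum _ fun j _ =>
      (hg k j).mul ((hw _ _).sub (hw _ _))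
  have hpair : Measurable fun ω => (covPath H T ω, fun (t : Set.Iic T) => B t ω) :=
    hX.prodMk hW
  have hlaw := (indepFun_iff_map_prod_eq_prod_map_map hX.aemeasurable hW.aemeasurable).1 hind
  have hFi : Integrable F ((Q.map (covPath H T)).prod (Q.map fun ω (t : Set.Iic T) => B t ω)) := by
    rw [← hlaw, integrable_map_measure hFm.aestronglyMeasurable hpair.aemeasurable]
    refine Integrable.of_bound (hFm.comp hpair).aestronglyMeasurable C (.of_forall fun ω => ?_)
    simp only [hF, Function.comp_apply, norm_mul, ← hζ']
    rw [mul_comm Complex.I, Complex.norm_exp_ofReal_mul_I, mul_one]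
    exact hC ω
  have := Measure.isProbabilityMeasure_map (μ := Q) hX.aemeasurable
  have := Measure.isProbabilityMeasure_map (μ := Q) hW.aemeasurable
  calc ∫ ω, Z ω * Complex.exp (Complex.I * (∑ i, u i * K.integral B T ω i : ℝ)) ∂Q
      = ∫ ω, F (covPath H T ω, fun (t : Set.Iic T) => B t ω) ∂Q := by
        refine integral_congr_ae (.of_forall fun ω => ?_)
        simp only [hF, e1, hζ']
    _ = ∫ p, F p ∂(Q.map (covPath H T)).prod (Q.map fun ω (t : Set.Iic T) => B t ω) := by
        rw [← hlaw, integral_map hpair.aemeasurable hFm.aestronglyMeasurable]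
    _ = ∫ x, ∫ w, F (x, w) ∂(Q.map fun ω (t : Set.Iic T) => B t ω) ∂(Q.map (covPath H T)) :=
        integral_prod _ hFi
    _ = ∫ x, ζ x * Complex.exp ((-(1 / 2) * ∑ k ∈ Finset.range N, ∑ j,
          γ k j x ^ 2 * ((τ (k + 1) : ℝ) - τ k) : ℝ)) ∂(Q.map (covPath H T)) := by
        refine integral_congr_ae (.of_forall fun x => ?_)
        simp only
        rw [integral_map (f := fun w => F (x, w)) hW.aemeasurable
          (hFm.comp measurable_prodMk_left).aestronglyMeasurable]
        simp only [hF]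
        rw [integral_const_mul, hB.integral_cexp_sum h.mono fun k j => γ k j x]
    _ = ∫ ω, Z ω * Complex.exp ((-(1 / 2) *
          ∫ s in (0 : ℝ)..T, rowQuad u (K.value s.toNNReal ω) : ℝ)) ∂Q := by
        rw [integral_map hX.aemeasurable]
        · refine integral_congr_ae (.of_forall fun ω => ?_)
          simp only [e2, hζ']
        · refine Measurable.aestronglyMeasurable ?_
          fun_prop

end StochCov

/-! ### Passage to the Itô integral -/

namespace StochCov

variable {Ω : Type*} {mΩ : MeasurableSpace Ω} {ℱ : Filtration ℝ≥0 mΩ} {Q : Measure Ω} {T : ℝ≥0}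
  {H : ℝ≥0 → Ω → Mat} {B : ℝ≥0 → Ω → Plane}

theorem rowQuad_nonneg (u : Plane) (a : Mat) : 0 ≤ rowQuad u a :=
  Finset.sum_nonneg fun _ _ => sq_nonneg _

/-- Write `x² - y² = (x - y)² + 2(x - y)y` and apply Young's inequality with weight `η`. The
remainder involves only `b`, so passing to the limit needs no uniform bound on `a`. -/
theorem abs_rowQuad_sub_le (u : Plane) (a b : Mat) {η : ℝ} (hη : 0 < η) :
    |rowQuad u a - rowQuad u b| ≤
      (1 + 1 / η) * (∑ i, u i ^ 2) * (∑ i, ∑ j, (a i j - b i j) ^ 2) + η * rowQuad u b := by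
  have key : ∀ x y : ℝ, |x ^ 2 - y ^ 2| ≤ (1 + 1 / η) * (x - y) ^ 2 + η * y ^ 2 := by
    intro x y
    have h1 : x ^ 2 - y ^ 2 = (x - y) ^ 2 + 2 * ((x - y) * y) := by ring
    have h2 : |2 * ((x - y) * y)| ≤ 1 / η * (x - y) ^ 2 + η * y ^ 2 := by
      have e1 : 0 ≤ 1 / η * (x - y - η * y) ^ 2 := by positivity
      have e2 : 0 ≤ 1 / η * (x - y + η * y) ^ 2 := by positivity
      have e3 : 1 / η * (x - y - η * y) ^ 2
          = 1 / η * (x - y) ^ 2 + η * y ^ 2 - 2 * ((x - y) * y) := by field_simp; ring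
      have e4 : 1 / η * (x - y + η * y) ^ 2
          = 1 / η * (x - y) ^ 2 + η * y ^ 2 + 2 * ((x - y) * y) := by field_simp; ring
      rw [abs_le]
      constructor <;> linarith
    rw [h1]
    refine (abs_add_le _ _).trans ?_
    rw [abs_of_nonneg (sq_nonneg _)]
    linarith
  have hcs : ∀ j, (∑ i, u i * a i j - ∑ i, u i * b i j) ^ 2
      ≤ (∑ i, u i ^ 2) * ∑ i, (a i j - b i j) ^ 2 := by
    intro j
    rw [← Finset.sum_sub_distrib]
    simp_rw [← mul_sub]
    exact Finset.sum_mul_sq_le_sq_mul_sq _ _ _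
  have h1η : 0 ≤ 1 + 1 / η := by positivity
  calc |rowQuad u a - rowQuad u b|
      ≤ ∑ j, |(∑ i, u i * a i j) ^ 2 - (∑ i, u i * b i j) ^ 2| := by
        rw [rowQuad, rowQuad, ← Finset.sum_sub_distrib]
        exact Finset.abs_sum_le_sum_abs _ _
    _ ≤ ∑ j, ((1 + 1 / η) * ((∑ i, u i ^ 2) * ∑ i, (a i j - b i j) ^ 2)
          + η * (∑ i, u i * b i j) ^ 2) :=
        Finset.sum_le_sum fun j _ => (key _ _).trans
          (by gcongr; exact hcs j)
    _ = _ := by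
        rw [Finset.sum_add_distrib, ← Finset.mul_sum, ← Finset.mul_sum, ← Finset.mul_sum, rowQuad,
          Finset.sum_comm (f := fun i j => (a i j - b i j) ^ 2)]
        ring

theorem SqIntegrable.integrable_rowQuad {a : ℝ≥0 → Mat} (ha : SqIntegrable T a) (u : Plane) :
    Integrable (fun s : ℝ => rowQuad u (a s.toNNReal))
      (volume.restrict (Set.Ioc (0 : ℝ) T)) := by
  refine integrable_finsetSum _ fun j _ => MemLp.integrable_sq ?_
  exact memLp_finsetSum _ fun i _ => (ha i j).const_mul (u i)

theorem tendsto_integral_rowQuad {a : ℕ → ℝ≥0 → Mat} {b : ℝ≥0 → Mat}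
    (ha : ∀ n, SqIntegrable T (a n)) (hb : SqIntegrable T b)
    (h : Tendsto (fun n => sqDist T (a n) b) atTop (𝓝 0)) (u : Plane) :
    Tendsto (fun n => ∫ s in (0 : ℝ)..T, rowQuad u (a n s.toNNReal)) atTop
      (𝓝 (∫ s in (0 : ℝ)..T, rowQuad u (b s.toNNReal))) := by
  set β := ∫ s in (0 : ℝ)..T, rowQuad u (b s.toNNReal) with hβ
  have hβ0 : 0 ≤ β := intervalIntegral.integral_nonneg T.2 fun s _ => rowQuad_nonneg u _
  have hdiff : ∀ η > 0, ∀ n, |(∫ s in (0 : ℝ)..T, rowQuad u (a n s.toNNReal)) - β| ≤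
      (1 + 1 / η) * (∑ i, u i ^ 2) * sqDist T (a n) b + η * β := by
    intro η hη n
    simp only [hβ, sqDist, integral_zero_coe]
    rw [← integral_sub ((ha n).integrable_rowQuad u) (hb.integrable_rowQuad u),
      ← integral_const_mul, ← integral_const_mul, ← integral_add
      (((ha n).integrable_sq_sub hb).const_mul _) ((hb.integrable_rowQuad u).const_mul _)]
    refine (abs_integral_le_integral_abs).trans (integral_mono
      (((ha n).integrable_rowQuad u).sub (hb.integrable_rowQuad u)).abs
      ((((ha n).integrable_sq_sub hb).const_mul _).add ((hb.integrable_rowQuad u).const_mul _))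
      fun s => abs_rowQuad_sub_le u _ _ hη)
  rw [Metric.tendsto_nhds]
  intro ε hε
  -- The summand 1 covers the case `β = 0`.
  set η := ε / (2 * (β + 1)) with hη
  have hη0 : 0 < η := by positivity
  have hηβ : η * β ≤ ε / 2 := by
    rw [hη, div_mul_eq_mul_div, div_le_div_iff₀ (by positivity) (by positivity)]
    nlinarith
  have hlim : Tendsto (fun n => (1 + 1 / η) * (∑ i, u i ^ 2) * sqDist T (a n) b) atTop (𝓝 0) := by
    simpa using h.const_mul ((1 + 1 / η) * (∑ i, u i ^ 2))
  filter_upwards [hlim.eventually_lt_const (half_pos hε)] with n hn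
  rw [Real.dist_eq]
  linarith [hdiff η hη0 n]

theorem ElementaryProcess.measurable_integral (hB : IsPlanarBrownian ℱ Q B)
    (K : ElementaryProcess ℱ) (t : ℝ≥0) (i : Fin 2) :
    Measurable fun ω => K.integral B t ω i := by
  simp_rw [ElementaryProcess.integral_apply]
  refine Finset.measurable_sum _ fun k _ => Finset.measurable_sum _ fun j _ => ?_
  exact ((K.measurable_coeff k i j).mono (ℱ.le _) le_rfl).mul
    (((hB.isFilteredBrownian j).measurable _).sub ((hB.isFilteredBrownian j).measurable _))

theorem ElementaryProcess.measurable_integral_rowQuad (K : ElementaryProcess ℱ) (T : ℝ≥0)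
    (u : Plane) : Measurable fun ω => ∫ s in (0 : ℝ)..T, rowQuad u (K.value s.toNNReal ω) := by
  simp_rw [integral_zero_coe]
  refine measurable_integral_path (g' := fun s ω => rowQuad u (K.value s.toNNReal ω)) ?_
    fun _ _ _ => rfl
  change Measurable fun p : ℝ × Ω => ∑ j, (∑ i, u i * K.value p.1.toNNReal p.2 i j) ^ 2
  exact Finset.measurable_sum _ fun j _ => (Finset.measurable_sum _ fun i _ =>
    (K.measurable_uncurry_value i j).const_mul _).pow_const 2

/-- The Itô integral of a process that is independent of the Brownian motion is conditionally
Gaussian. -/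
theorem IsItoIntegral.integral_mul_cexp [IsProbabilityMeasure Q] {M : ℝ≥0 → Ω → Plane}
    (hM : IsItoIntegral ℱ Q B H T M) (hB : IsPlanarBrownian ℱ Q B)
    (hind : IndepFun (covPath H T) (fun ω (t : Set.Iic T) => B t ω) Q)
    {Z : Ω → ℂ} (hZ : Measurable[pathAlgebra H T] Z) {C : ℝ} (hC : ∀ ω, ‖Z ω‖ ≤ C) (u : Plane) :
    ∫ ω, Z ω * Complex.exp (Complex.I * (∑ i, u i * M T ω i : ℝ)) ∂Q
      = ∫ ω, Z ω * Complex.exp ((-(1 / 2) *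
          ∫ s in (0 : ℝ)..T, rowQuad u (H s.toNNReal ω) : ℝ)) ∂Q := by
  have hH := hM.progressive
  have hsq := ae_sqIntegrable hH hM.sq_integrable
  obtain ⟨G, hG, hGM⟩ := hM.exists_approx
  obtain ⟨K, hKm, hK⟩ := exists_seq_elementary (Q := Q) hH hsq
  have hKG := tendstoInMeasure_integral_sub hB hsq hK hG
  -- Three successive extractions give one subsequence along which, almost surely, the integrals of
  -- `K` and `G` merge, those of `G` tend to `M T`, and `K` tends to `H` in squared distance.
  obtain ⟨φ, hφ, hφae⟩ := hKG.exists_seq_tendsto_ae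
  obtain ⟨ψ, hψ, hψae⟩ := ((hGM T le_rfl).comp hφ.tendsto_atTop).exists_seq_tendsto_ae
  obtain ⟨χ, hχ, hχae⟩ := (hK.comp (hφ.tendsto_atTop.comp hψ.tendsto_atTop)).exists_seq_tendsto_ae
  set ν : ℕ → ℕ := fun n => φ (ψ (χ n)) with hν
  have hconv : ∀ᵐ ω ∂Q, Tendsto (fun n => (K (ν n)).integral B T ω) atTop (𝓝 (M T ω)) := by
    filter_upwards [hφae, hψae] with ω h1 h2
    have h3 := (h1.comp (hψ.tendsto_atTop.comp hχ.tendsto_atTop)).add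
      (h2.comp hχ.tendsto_atTop)
    simpa [hν, Function.comp_def] using h3
  have hquad : ∀ᵐ ω ∂Q, Tendsto
      (fun n => ∫ s in (0 : ℝ)..T, rowQuad u ((K (ν n)).value s.toNNReal ω)) atTop
      (𝓝 (∫ s in (0 : ℝ)..T, rowQuad u (H s.toNNReal ω))) := by
    filter_upwards [hχae, hsq] with ω h1 h2
    exact tendsto_integral_rowQuad (a := fun n t => (K (ν n)).value t ω)
      (fun n => (K (ν n)).sqIntegrable_value T ω) h2 h1 u
  have hZm : Measurable Z := hZ.mono (pathAlgebra_le hH T) le_rfl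
  have lim1 : Tendsto (fun n => ∫ ω, Z ω * Complex.exp (Complex.I *
      (∑ i, u i * (K (ν n)).integral B T ω i : ℝ)) ∂Q) atTop
      (𝓝 (∫ ω, Z ω * Complex.exp (Complex.I * (∑ i, u i * M T ω i : ℝ)) ∂Q)) := by
    refine tendsto_integral_of_dominated_convergence (fun _ => C) (fun n => ?_)
      (integrable_const C) (fun n => .of_forall fun ω => ?_) ?_
    · have := fun i => (K (ν n)).measurable_integral hB T i
      refine Measurable.aestronglyMeasurable (hZm.mul (Complex.measurable_exp.comp
        (Measurable.const_mul (Complex.measurable_ofReal.comp ?_) _)))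
      exact Finset.measurable_sum _ fun i _ => (this i).const_mul _
    · rw [norm_mul, mul_comm Complex.I, Complex.norm_exp_ofReal_mul_I, mul_one]
      exact hC ω
    · filter_upwards [hconv] with ω hω
      have hc : Continuous fun x : Plane =>
        Z ω * Complex.exp (Complex.I * (∑ i, u i * x i : ℝ)) := by fun_prop
      exact (hc.tendsto (M T ω)).comp hω
  have lim2 : Tendsto (fun n => ∫ ω, Z ω * Complex.exp ((-(1 / 2) *
          ∫ s in (0 : ℝ)..T, rowQuad u ((K (ν n)).value s.toNNReal ω) : ℝ)) ∂Q) atTop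
      (𝓝 (∫ ω, Z ω * Complex.exp ((-(1 / 2) *
          ∫ s in (0 : ℝ)..T, rowQuad u (H s.toNNReal ω) : ℝ)) ∂Q)) := by
    refine tendsto_integral_of_dominated_convergence (fun _ => C) (fun n => ?_)
      (integrable_const C) (fun n => .of_forall fun ω => ?_) ?_
    · have := (K (ν n)).measurable_integral_rowQuad T u
      refine Measurable.aestronglyMeasurable (hZm.mul (Complex.measurable_exp.comp
        (Complex.measurable_ofReal.comp (this.const_mul _))))
    · rw [norm_mul, ← Complex.ofReal_exp, Complex.norm_real, Real.norm_of_nonneg (Real.exp_nonneg _)]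
      have h0 : 0 ≤ ∫ s in (0 : ℝ)..T, rowQuad u ((K (ν n)).value s.toNNReal ω) :=
        intervalIntegral.integral_nonneg T.2 fun s _ => rowQuad_nonneg u _
      have h1 : Real.exp (-(1 / 2) * ∫ s in (0 : ℝ)..T,
          rowQuad u ((K (ν n)).value s.toNNReal ω)) ≤ 1 := Real.exp_le_one_iff.2 (by linarith)
      calc ‖Z ω‖ * _ ≤ ‖Z ω‖ * 1 := by gcongr
        _ ≤ C := by rw [mul_one]; exact hC ω
    · filter_upwards [hquad] with ω hω
      have hc : Continuous fun x : ℝ => Z ω * Complex.exp ((-(1 / 2) * x : ℝ)) := by fun_prop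
      exact (hc.tendsto _).comp hω
  refine tendsto_nhds_unique lim1 (lim2.congr fun n => ?_)
  exact (integral_mul_cexp_elementary hB hH hind (hKm _) hZ hC u).symm

end StochCov

/-! ### Measurability of time integrals -/

namespace StochCov

variable {Ω : Type*} {m mΩ : MeasurableSpace Ω} {ℱ : Filtration ℝ≥0 mΩ} {Q : Measure Ω} {T : ℝ≥0}

/-- The factor `w` can be pulled out of the conditional expectation, and what remains has
conditional mean 0. -/
theorem integral_mul_sub_condExp_eq_zero [IsFiniteMeasure Q]
    (hm : m ≤ mΩ) {w I : Ω → ℝ} {C : ℝ} (hw : StronglyMeasurable[m] w)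
    (hwC : ∀ᵐ ω ∂Q, ‖w ω‖ ≤ C) (hI : Integrable I Q) :
    ∫ ω, w ω * (I ω - (Q[I|m]) ω) ∂Q = 0 := by
  have hJ : Integrable (I - Q[I|m]) Q := hI.sub integrable_condExp
  have hwJ : Integrable (w * (I - Q[I|m])) Q :=
    hJ.bdd_mul (hw.mono hm).aestronglyMeasurable hwC
  have h1 : Q[I - Q[I|m]|m] =ᵐ[Q] 0 := by
    refine (condExp_sub hI integrable_condExp m).trans ?_
    rw [condExp_of_stronglyMeasurable hm stronglyMeasurable_condExp integrable_condExp, sub_self]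
  have h2 : Q[w * (I - Q[I|m])|m] =ᵐ[Q] 0 := by
    refine (condExp_mul_of_stronglyMeasurable_left hw hwJ hJ).trans ?_
    filter_upwards [h1] with ω hω
    simp [hω]
  calc ∫ ω, w ω * (I ω - (Q[I|m]) ω) ∂Q = ∫ ω, (w * (I - Q[I|m])) ω ∂Q := rfl
    _ = ∫ ω, (Q[w * (I - Q[I|m])|m]) ω ∂Q := (integral_condExp hm).symm
    _ = 0 := by rw [integral_congr_ae h2]; simp

/-- The time integral of a bounded process is measurable, up to null sets, for every σ-algebra
that makes the process measurable at all times. -/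
theorem aestronglyMeasurable_integral_of_bounded [IsFiniteMeasure Q]
    (hm : m ≤ mΩ) {x : ℝ → Ω → ℝ} (hx : Measurable (Function.uncurry x))
    (hxm : ∀ s, Measurable[m] (x s)) {C : ℝ} (hC : ∀ s ω, |x s ω| ≤ C) :
    AEStronglyMeasurable[m] (fun ω => ∫ s in Set.Ioc (0 : ℝ) T, x s ω) Q := by
  set I : Ω → ℝ := fun ω => ∫ s in Set.Ioc (0 : ℝ) T, x s ω with hI
  have hIm : Measurable I := (hx.stronglyMeasurable.integral_prod_left
    (μ := volume.restrict (Set.Ioc (0 : ℝ) T))).measurable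
  have hIC : ∀ ω, ‖I ω‖ ≤ C * T := fun ω => by
    have := norm_setIntegral_le_of_norm_le_const (μ := volume) (s := Set.Ioc (0 : ℝ) T)
      (f := fun s => x s ω) (C := C) (by simp) fun s _ => hC s ω
    simpa using this
  have hIi : Integrable I Q := Integrable.of_bound hIm.aestronglyMeasurable (C * T)
    (.of_forall hIC)
  have hcondC : ∀ᵐ ω ∂Q, ‖(Q[I|m]) ω‖ ≤ C * T :=
    ae_bdd_abs_condExp_of_ae_bdd_abs (.of_forall hIC)
  -- Measurability for `m` at each single time gives no joint measurability, so Fubini does not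
  -- settle the claim directly. Instead `J` is shown orthogonal to `I`, by exchanging integrals and
  -- using the `m`-measurable weight `x s` for each `s`, and to `Q[I|m]`. Hence `J²` has mean 0 and
  -- `I` agrees almost surely with its conditional expectation.
  set J : Ω → ℝ := fun ω => I ω - (Q[I|m]) ω with hJ
  have hJi : Integrable J Q := hIi.sub integrable_condExp
  have hJI : ∫ ω, I ω * J ω ∂Q = 0 := by
    have hprod : Integrable (fun p : Ω × ℝ => x p.2 p.1 * J p.1)
        (Q.prod (volume.restrict (Set.Ioc (0 : ℝ) T))) := by
      refine (hJi.comp_fst _).bdd_mul (c := C) ?_ (.of_forall fun p => hC _ _)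
      exact (hx.comp measurable_swap).aestronglyMeasurable
    calc ∫ ω, I ω * J ω ∂Q = ∫ ω, ∫ s in Set.Ioc (0 : ℝ) T, x s ω * J ω ∂volume ∂Q := by
          simp_rw [integral_mul_const, hI]
      _ = ∫ s in Set.Ioc (0 : ℝ) T, ∫ ω, x s ω * J ω ∂Q := integral_integral_swap hprod
      _ = 0 := by
          simp_rw [hJ, integral_mul_sub_condExp_eq_zero hm (hxm _).stronglyMeasurable
            (.of_forall fun ω => hC _ ω) hIi]
          simp
  have hJE : ∫ ω, (Q[I|m]) ω * J ω ∂Q = 0 :=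
    integral_mul_sub_condExp_eq_zero hm stronglyMeasurable_condExp hcondC hIi
  have hJJ : ∫ ω, J ω ^ 2 ∂Q = 0 := by
    have e : ∀ ω, J ω ^ 2 = I ω * J ω - (Q[I|m]) ω * J ω := fun ω => by simp only [hJ]; ring
    simp_rw [e]
    rw [integral_sub, hJI, hJE, sub_zero]
    · exact hJi.bdd_mul (c := C * T) hIm.aestronglyMeasurable (.of_forall hIC)
    · exact hJi.bdd_mul (c := C * T) integrable_condExp.1 hcondC
  have hJ2 : Integrable (fun ω => J ω ^ 2) Q := by
    simp_rw [pow_two]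
    refine hJi.bdd_mul (c := C * T + C * T) hJi.1 ?_
    filter_upwards [hcondC] with ω hω
    exact (norm_sub_le _ _).trans (add_le_add (hIC ω) hω)
  have hJ0 := (integral_eq_zero_iff_of_nonneg (fun ω => sq_nonneg (J ω)) hJ2).1 hJJ
  refine AEStronglyMeasurable.congr stronglyMeasurable_condExp.aestronglyMeasurable
    (f := Q[I|m]) ?_
  filter_upwards [hJ0] with ω hω
  have : J ω = 0 := by simpa using hω
  simp only [hJ] at this
  linarith

/-- Null sets need not belong to `m`, so the limit is represented by the limsup of `m`-measurable
versions. -/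
theorem aestronglyMeasurable_of_tendsto_ae_sub {f : ℕ → Ω → ℝ} {g : Ω → ℝ}
    (hf : ∀ n, AEStronglyMeasurable[m] (f n) Q)
    (h : ∀ᵐ ω ∂Q, Tendsto (fun n => f n ω) atTop (𝓝 (g ω))) : AEStronglyMeasurable[m] g Q := by
  have hmeas : Measurable[m] fun ω => limsup (fun n => (hf n).mk (f n) ω) atTop :=
    Measurable.limsup fun n => (hf n).stronglyMeasurable_mk.measurable
  refine ⟨_, hmeas.stronglyMeasurable, ?_⟩
  have hall : ∀ᵐ ω ∂Q, ∀ n, f n ω = (hf n).mk (f n) ω := ae_all_iff.2 fun n => (hf n).ae_eq_mk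
  filter_upwards [h, hall] with ω h1 h2
  simp_rw [h2] at h1
  exact h1.limsup_eq.symm

/-- The time integral of a progressive process with integrable paths is measurable, up to null
sets, for every σ-algebra that makes the process measurable at all times up to `T`. -/
theorem aestronglyMeasurable_integral [IsFiniteMeasure Q]
    (hm : m ≤ mΩ) {x : ℝ≥0 → Ω → ℝ} (hx : IsStronglyProgressive ℱ x)
    (hxm : ∀ t ≤ T, Measurable[m] (x t))
    (hint : ∀ᵐ ω ∂Q, IntegrableOn (fun s : ℝ => x s.toNNReal ω) (Set.Ioc (0 : ℝ) T)) :
    AEStronglyMeasurable[m] (fun ω => ∫ s in Set.Ioc (0 : ℝ) T, x s.toNNReal ω) Q := by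
  refine aestronglyMeasurable_of_tendsto_ae_sub (f := fun (n : ℕ) ω =>
    ∫ s in Set.Ioc (0 : ℝ) T, clip n (x (min s.toNNReal T) ω)) (fun n => ?_) ?_
  · exact aestronglyMeasurable_integral_of_bounded hm
      (x := fun s ω => clip n (x (min s.toNNReal T) ω))
      ((continuous_clip n).measurable.comp (measurable_uncurry_min hx T))
      (fun s => (continuous_clip n).measurable.comp (hxm _ (min_le_right _ _)))
      fun s ω => abs_clip_le n.cast_nonneg _
  · filter_upwards [hint] with ω hω
    have hlim := tendsto_integral_of_dominated_convergence
      (μ := volume.restrict (Set.Ioc (0 : ℝ) T))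
      (F := fun (n : ℕ) (s : ℝ) => clip n (x s.toNNReal ω)) (f := fun s => x s.toNNReal ω)
      (fun s : ℝ => |x s.toNNReal ω|) (fun n => ?_) ?_ (fun n => ?_) ?_
    · refine hlim.congr fun n => setIntegral_congr_fun measurableSet_Ioc fun s hs => ?_
      simp only [min_eq_left (toNNReal_le_of_mem hs)]
    · exact (continuous_clip n).comp_aestronglyMeasurable hω.1
    · exact hω.abs
    · refine .of_forall fun s => ?_
      rw [Real.norm_eq_abs]
      rcases le_total |x s.toNNReal ω| n with h | h
      · rw [clip_eq_self h]
      · exact (abs_clip_le n.cast_nonneg _).trans h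
    · refine .of_forall fun s => tendsto_const_nhds.congr' ?_
      obtain ⟨k, hk⟩ := exists_nat_ge |x s.toNNReal ω|
      filter_upwards [eventually_ge_atTop k] with n hn
      rw [clip_eq_self (hk.trans (by exact_mod_cast hn))]

end StochCov

/-! ### The price model and its conditional law -/

namespace StochCov

variable {Ω : Type*} {mΩ : MeasurableSpace Ω} {ℱ : Filtration ℝ≥0 mΩ} {Q : Measure Ω} {T : ℝ≥0}
  {r : ℝ} {q : Plane} {S Y B : ℝ≥0 → Ω → Plane} {V H : ℝ≥0 → Ω → Mat}

theorem entry_eq_of_sq_eq {a v : Mat} (hs : a.IsSymm) (h : a * a = v) (i k : Fin 2) :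
    v i k = ∑ j, a i j * a k j := by
  rw [← h, Matrix.mul_apply]
  exact Finset.sum_congr rfl fun j _ => by rw [hs.apply k j]

theorem rowQuad_eq_of_sq_eq {a v : Mat} (hs : a.IsSymm) (h : a * a = v) (u : Plane) :
    rowQuad u a = ∑ i, ∑ k, u i * u k * v i k := by
  simp only [rowQuad, entry_eq_of_sq_eq hs h, Fin.sum_univ_two]
  ring

namespace IsPriceModel

theorem progressive (h : IsPriceModel ℱ Q r q T S Y B V H) (i j : Fin 2) :
    IsStronglyProgressive ℱ fun t ω => H t ω i j := by
  obtain ⟨M, hM, -⟩ := h.dynamics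
  exact hM.progressive i j

theorem ae_sqIntegrable (h : IsPriceModel ℱ Q r q T S Y B V H) :
    ∀ᵐ ω ∂Q, SqIntegrable T fun t => H t ω := by
  obtain ⟨M, hM, -⟩ := h.dynamics
  exact StochCov.ae_sqIntegrable hM.progressive hM.sq_integrable

theorem entry_eq (h : IsPriceModel ℱ Q r q T S Y B V H) {t : ℝ≥0} (ht : t ≤ T) (ω : Ω)
    (i k : Fin 2) : V t ω i k = ∑ j, H t ω i j * H t ω k j :=
  entry_eq_of_sq_eq (h.sqrt_symm t ht ω) (h.sqrt_mul_sqrt t ht ω) i k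

theorem integrableOn_entry (h : IsPriceModel ℱ Q r q T S Y B V H) :
    ∀ᵐ ω ∂Q, ∀ i k, IntegrableOn (fun s : ℝ => V s.toNNReal ω i k) (Set.Ioc (0 : ℝ) T) := by
  filter_upwards [h.ae_sqIntegrable] with ω hω i k
  have : Integrable (fun s : ℝ => ∑ j, H s.toNNReal ω i j * H s.toNNReal ω k j)
      (volume.restrict (Set.Ioc (0 : ℝ) T)) :=
    integrable_finsetSum _ fun j _ => (hω i j).integrable_mul (hω k j)
  refine this.congr ?_
  filter_upwards [ae_restrict_mem measurableSet_Ioc] with s hs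
  rw [h.entry_eq (toNNReal_le_of_mem hs)]

/-- `Σ` is a function of its root, while a root may carry more information, such as signs. Weights
depending on `Σ` are thus admissible in identities that hold for weights depending on `H`. -/
theorem pathAlgebra_le_sqrt (h : IsPriceModel ℱ Q r q T S Y B V H) :
    pathAlgebra V T ≤ pathAlgebra H T := by
  refine (measurable_covPath (m := pathAlgebra H T) fun t ht i k => ?_).comap_le
  simp_rw [h.entry_eq ht]
  exact Finset.measurable_sum _ fun j _ => (measurable_pathAlgebra_entry H ht i j).mul
    (measurable_pathAlgebra_entry H ht k j)

theorem pathAlgebra_le (h : IsPriceModel ℱ Q r q T S Y B V H) : pathAlgebra V T ≤ mΩ :=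
  h.pathAlgebra_le_sqrt.trans (StochCov.pathAlgebra_le h.progressive T)

/-- Conditioning on `Σ` needs measurability for the path of `V` itself, not only of `H`.
Progressivity is available for `H`, so the integrand is rewritten through it. -/
theorem aestronglyMeasurable_intCov [IsFiniteMeasure Q]
    (h : IsPriceModel ℱ Q r q T S Y B V H) (i k : Fin 2) :
    AEStronglyMeasurable[pathAlgebra V T] (fun ω => intCov V T ω i k) Q := by
  have hprog : IsStronglyProgressive ℱ fun t ω => ∑ j, H t ω i j * H t ω k j := fun t =>
    Finset.stronglyMeasurable_fun_sum _ fun j _ =>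
      (h.progressive i j t).mul (h.progressive k j t)
  have heq : (fun ω => intCov V T ω i k) = fun ω => ∫ s in Set.Ioc (0 : ℝ) T,
      ∑ j, H s.toNNReal ω i j * H s.toNNReal ω k j := by
    ext ω
    simp only [intCov, Matrix.of_apply, integral_zero_coe]
    exact setIntegral_congr_fun measurableSet_Ioc fun s hs => h.entry_eq (toNNReal_le_of_mem hs) ω i k
  rw [heq]
  refine aestronglyMeasurable_integral h.pathAlgebra_le hprog (fun t ht => ?_) ?_
  · have := measurable_pathAlgebra_entry V ht i k
    simp_rw [h.entry_eq ht] at this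
    exact this
  · filter_upwards [h.ae_sqIntegrable] with ω hω
    exact integrable_finsetSum _ fun j _ => (hω i j).integrable_mul (hω k j)

/-- For a symmetric root, `uᵀ H H u = |H u|²`. This identifies the variance of the Itô integral and
yields positivity, with one null set for all `u`. -/
theorem quadForm_intCov (h : IsPriceModel ℱ Q r q T S Y B V H) :
    ∀ᵐ ω ∂Q, ∀ u : Plane, ∑ i, ∑ k, u i * u k * intCov V T ω i k
      = ∫ s in (0 : ℝ)..T, rowQuad u (H s.toNNReal ω) := by
  filter_upwards [h.integrableOn_entry] with ω hω u
  simp only [intCov, Matrix.of_apply, integral_zero_coe]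
  simp_rw [← integral_const_mul]
  have hi : ∀ i k, Integrable (fun s : ℝ => u i * u k * V s.toNNReal ω i k)
      (volume.restrict (Set.Ioc (0 : ℝ) T)) := fun i k => (hω i k).const_mul _
  simp_rw [← integral_finsetSum _ fun k _ => hi _ k]
  rw [← integral_finsetSum _ fun i _ => integrable_finsetSum _ fun k _ => hi i k]
  refine setIntegral_congr_fun measurableSet_Ioc fun s hs => ?_
  have hsT := toNNReal_le_of_mem hs
  exact (rowQuad_eq_of_sq_eq (h.sqrt_symm _ hsT ω) (h.sqrt_mul_sqrt _ hsT ω) u).symm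

theorem quadForm_nonneg (h : IsPriceModel ℱ Q r q T S Y B V H) :
    ∀ᵐ ω ∂Q, ∀ u : Plane, 0 ≤ ∑ i, ∑ k, u i * u k * intCov V T ω i k := by
  filter_upwards [h.quadForm_intCov] with ω hω u
  rw [hω]
  exact intervalIntegral.integral_nonneg T.2 fun s _ => rowQuad_nonneg u _

theorem posSemidef_intCov (h : IsPriceModel ℱ Q r q T S Y B V H) :
    ∀ᵐ ω ∂Q, (intCov V T ω).PosSemidef := by
  filter_upwards [h.quadForm_nonneg] with ω hω
  refine Matrix.PosSemidef.of_dotProduct_mulVec_nonneg ?_ fun x => ?_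
  · ext i k
    simp only [Matrix.conjTranspose_apply, star_trivial, intCov, Matrix.of_apply,
      integral_zero_coe]
    refine setIntegral_congr_fun measurableSet_Ioc fun s hs => ?_
    have hsT := toNNReal_le_of_mem hs
    simp only [h.entry_eq hsT]
    exact Finset.sum_congr rfl fun j _ => mul_comm _ _
  · have := hω (WithLp.toLp 2 x)
    simp only [Fin.sum_univ_two] at this
    simp only [dotProduct, Matrix.mulVec, Fin.sum_univ_two, Pi.star_apply, star_trivial]
    linarith

/-- The conditional mean of `u · Y_T` given the covariance path. -/
noncomputable def condMean (r : ℝ) (q : Plane) (T : ℝ≥0) (V : ℝ≥0 → Ω → Mat) (u : Plane)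
    (ω : Ω) : ℝ :=
  ∑ j, u j * ((r - q j) * T - 1 / 2 * intCov V T ω j j)

theorem logPrice_eq (h : IsPriceModel ℱ Q r q T S Y B V H) :
    ∃ M : ℝ≥0 → Ω → Plane, IsItoIntegral ℱ Q B H T M ∧
      ∀ᵐ ω ∂Q, ∀ u : Plane, ∑ j, u j * Y T ω j = condMean r q T V u ω + ∑ j, u j * M T ω j := by
  obtain ⟨M, hM, hdyn⟩ := h.dynamics
  refine ⟨M, hM, ?_⟩
  filter_upwards [h.initial_pos, h.price 0 zero_le, hdyn T le_rfl, h.integrableOn_entry]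
    with ω hpos hprice hY hint u
  -- The price relation at time 0 reads `S₀ = S₀ exp(Y₀)` with `S₀ > 0`, which forces `Y₀ = 0`.
  have hY0 : ∀ j, Y 0 ω j = 0 := by
    intro j
    have h1 := hprice j
    have h2 := (hpos j).ne'
    have h3 : Real.exp (Y 0 ω j) = 1 := by
      have : S 0 ω j * Real.exp (Y 0 ω j) = S 0 ω j * 1 := by rw [mul_one]; exact h1.symm
      exact mul_left_cancel₀ h2 this
    exact (Real.exp_eq_one_iff _).1 h3
  have hdrift : ∀ j, ∫ s in (0 : ℝ)..T, (r - q j - 1 / 2 * V s.toNNReal ω j j)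
      = (r - q j) * T - 1 / 2 * intCov V T ω j j := by
    intro j
    simp only [intCov, Matrix.of_apply, integral_zero_coe]
    rw [integral_sub (integrable_const _) ((hint j j).const_mul _), integral_const_mul]
    simp [mul_comm]
  rw [condMean, ← Finset.sum_add_distrib]
  refine Finset.sum_congr rfl fun j _ => ?_
  rw [hY j, hY0, hdrift]
  ring

/-- The conditional characteristic function of `Y_T` given the covariance path. -/
noncomputable def condCharFun (r : ℝ) (q : Plane) (T : ℝ≥0) (V : ℝ≥0 → Ω → Mat) (u : Plane)
    (ω : Ω) : ℂ :=
  Complex.exp (Complex.I * (condMean r q T V u ω : ℝ)) *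
    Complex.exp ((-(1 / 2) * ∑ i, ∑ k, u i * u k * intCov V T ω i k : ℝ))

theorem aestronglyMeasurable_condMean [IsFiniteMeasure Q]
    (h : IsPriceModel ℱ Q r q T S Y B V H) (u : Plane) :
    AEStronglyMeasurable[pathAlgebra V T] (condMean r q T V u) Q := by
  have hj : ∀ j, AEStronglyMeasurable[pathAlgebra V T]
      (fun ω => u j * ((r - q j) * T - 1 / 2 * intCov V T ω j j)) Q := fun j =>
    (aestronglyMeasurable_const.sub ((h.aestronglyMeasurable_intCov j j).const_mul _)).const_mul _
  unfold condMean
  simp_rw [Fin.sum_univ_two]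
  exact (hj 0).add (hj 1)

theorem aestronglyMeasurable_condCharFun [IsFiniteMeasure Q]
    (h : IsPriceModel ℱ Q r q T S Y B V H) (u : Plane) :
    AEStronglyMeasurable[pathAlgebra V T] (condCharFun r q T V u) Q := by
  have h1 : Continuous fun x : ℝ => Complex.exp (Complex.I * x) := by fun_prop
  have h2 : Continuous fun x : ℝ => Complex.exp ((-(1 / 2) * x : ℝ)) := by fun_prop
  have h3 : AEStronglyMeasurable[pathAlgebra V T]
      (fun ω => ∑ i, ∑ k, u i * u k * intCov V T ω i k) Q := by
    have hik : ∀ i k, AEStronglyMeasurable[pathAlgebra V T]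
        (fun ω => u i * u k * intCov V T ω i k) Q := fun i k =>
      (h.aestronglyMeasurable_intCov i k).const_mul _
    simp_rw [Fin.sum_univ_two]
    exact ((hik 0 0).add (hik 0 1)).add ((hik 1 0).add (hik 1 1))
  exact (h1.comp_aestronglyMeasurable (h.aestronglyMeasurable_condMean u)).mul
    (h2.comp_aestronglyMeasurable h3)

/-- Positive semidefiniteness keeps the real exponent nonpositive; this is why the expectation at
the complex matrix argument exists. -/
theorem norm_condCharFun_le (h : IsPriceModel ℱ Q r q T S Y B V H) (u : Plane) :
    ∀ᵐ ω ∂Q, ‖condCharFun r q T V u ω‖ ≤ 1 := by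
  filter_upwards [h.quadForm_nonneg] with ω hω
  rw [condCharFun, norm_mul, mul_comm Complex.I, Complex.norm_exp_ofReal_mul_I, one_mul,
    ← Complex.ofReal_exp, Complex.norm_real, Real.norm_of_nonneg (Real.exp_nonneg _)]
  exact Real.exp_le_one_iff.2 (by have := hω u; linarith)

theorem integrable_condCharFun [IsFiniteMeasure Q]
    (h : IsPriceModel ℱ Q r q T S Y B V H) (u : Plane) :
    Integrable (condCharFun r q T V u) Q :=
  Integrable.of_bound ((h.aestronglyMeasurable_condCharFun u).mono h.pathAlgebra_le) 1
    (h.norm_condCharFun_le u)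

theorem measurable_logPrice (h : IsPriceModel ℱ Q r q T S Y B V H) : Measurable (Y T) :=
  (h.adapted T le_rfl).mono (ℱ.le T) le_rfl

theorem integrable_cexp_logPrice [IsFiniteMeasure Q] (h : IsPriceModel ℱ Q r q T S Y B V H)
    (u : Plane) : Integrable (fun ω => Complex.exp (Complex.I * (∑ j, u j * Y T ω j : ℝ))) Q := by
  have hY := h.measurable_logPrice
  refine Integrable.of_bound (Measurable.aestronglyMeasurable ?_) 1 (.of_forall fun ω => ?_)
  · have : Measurable fun y : Plane => Complex.exp (Complex.I * (∑ j, u j * y j : ℝ)) := by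
      fun_prop
    exact this.comp hY
  · rw [mul_comm Complex.I, Complex.norm_exp_ofReal_mul_I]

/-- Over an event of the path of `Σ`, both integrals are the two sides of
`IsItoIntegral.integral_mul_cexp`, with the indicator times the phase of the conditional mean as
weight. -/
theorem condCharFun_ae_eq_condExp [IsProbabilityMeasure Q]
    (h : IsPriceModel ℱ Q r q T S Y B V H) (u : Plane) :
    condCharFun r q T V u =ᵐ[Q]
      Q[fun ω => Complex.exp (Complex.I * (∑ j, u j * Y T ω j : ℝ))|pathAlgebra V T] := by
  refine ae_eq_condExp_of_forall_setIntegral_eq h.pathAlgebra_le (h.integrable_cexp_logPrice u)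
    (fun s _ _ => (h.integrable_condCharFun u).integrableOn) (fun s hs _ => ?_)
    (h.aestronglyMeasurable_condCharFun u)
  obtain ⟨M, hM, hY⟩ := h.logPrice_eq
  have hmean := h.aestronglyMeasurable_condMean u
  -- The conditional mean is measurable for this σ-algebra only up to null sets; a genuinely
  -- measurable version makes `Z` an admissible weight.
  set μ' : Ω → ℝ := hmean.mk _ with hμ'
  set Z : Ω → ℂ := s.indicator fun ω => Complex.exp (Complex.I * (μ' ω : ℝ)) with hZ
  have hZm : Measurable[pathAlgebra V T] Z := by
    have : Measurable fun x : ℝ => Complex.exp (Complex.I * x) := by fun_prop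
    exact (this.comp hmean.stronglyMeasurable_mk.measurable).indicator hs
  have hZ1 : ∀ ω, ‖Z ω‖ ≤ 1 := by
    intro ω
    by_cases hω : ω ∈ s
    · simp only [hZ, Set.indicator_of_mem hω]
      rw [mul_comm Complex.I, Complex.norm_exp_ofReal_mul_I]
    · simp [hZ, Set.indicator_of_notMem hω]
  have key := hM.integral_mul_cexp h.brownian h.indep
    (hZm.mono h.pathAlgebra_le_sqrt le_rfl) hZ1 u
  have hs' : MeasurableSet s := h.pathAlgebra_le s hs
  rw [← integral_indicator hs', ← integral_indicator hs']
  calc ∫ ω, s.indicator (condCharFun r q T V u) ω ∂Q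
      = ∫ ω, Z ω * Complex.exp ((-(1 / 2) *
          ∫ s in (0 : ℝ)..T, rowQuad u (H s.toNNReal ω) : ℝ)) ∂Q := by
        refine integral_congr_ae ?_
        filter_upwards [h.quadForm_intCov, hmean.ae_eq_mk] with ω h1 h2
        by_cases hω : ω ∈ s
        · simp only [hZ, Set.indicator_of_mem hω, condCharFun, h1 u, h2, hμ']
        · simp only [hZ, Set.indicator_of_notMem hω, zero_mul]
    _ = ∫ ω, Z ω * Complex.exp (Complex.I * (∑ i, u i * M T ω i : ℝ)) ∂Q := key.symm
    _ = ∫ ω, s.indicator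
          (fun ω => Complex.exp (Complex.I * (∑ j, u j * Y T ω j : ℝ))) ω ∂Q := by
        refine integral_congr_ae ?_
        filter_upwards [hY, hmean.ae_eq_mk] with ω h1 h2
        by_cases hω : ω ∈ s
        · simp only [hZ, Set.indicator_of_mem hω, h1 u, h2, hμ']
          rw [← Complex.exp_add, ← mul_add, Complex.ofReal_add]
        · simp only [hZ, Set.indicator_of_notMem hω, zero_mul]

theorem integral_condCharFun [IsProbabilityMeasure Q]
    (h : IsPriceModel ℱ Q r q T S Y B V H) (u : Plane) :
    ∫ ω, condCharFun r q T V u ω ∂Q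
      = ∫ ω, Complex.exp (Complex.I * (∑ j, u j * Y T ω j : ℝ)) ∂Q := by
  rw [integral_congr_ae (h.condCharFun_ae_eq_condExp u), integral_condExp h.pathAlgebra_le]

end IsPriceModel

theorem charFun_plane (ν : Measure Plane) (u : Plane) :
    charFun ν u = ∫ y, Complex.exp (Complex.I * (∑ j, u j * y j : ℝ)) ∂ν := by
  rw [charFun_apply]
  refine integral_congr_ae (.of_forall fun y => ?_)
  simp only [PiLp.inner_apply, RCLike.inner_apply, conj_trivial]
  rw [mul_comm]

namespace IsPriceModel

theorem condDistrib_logPrice [IsProbabilityMeasure Q] (h : IsPriceModel ℱ Q r q T S Y B V H) :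
    ∀ᵐ ω ∂Q, condDistrib (Y T) (covPath V T) Q (covPath V T ω) = multivariateGaussian
      (WithLp.toLp 2 fun j => (r - q j) * T - 1 / 2 * intCov V T ω j j) (intCov V T ω) := by
  have hX : Measurable (covPath V T) := by
    rw [measurable_iff_comap_le]; exact h.pathAlgebra_le
  -- The exceptional null set depends on `u`, so only countably many `u` are used; continuity of
  -- characteristic functions does the rest.
  obtain ⟨D, hDc, hDd⟩ := TopologicalSpace.exists_countable_dense Plane
  have hae : ∀ᵐ ω ∂Q, ∀ u ∈ D, charFun (condDistrib (Y T) (covPath V T) Q (covPath V T ω)) u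
      = condCharFun r q T V u ω := by
    rw [ae_ball_iff hDc]
    intro u _
    have hf : StronglyMeasurable fun y : Plane =>
        Complex.exp (Complex.I * (∑ j, u j * y j : ℝ)) :=
      Continuous.stronglyMeasurable (by fun_prop)
    have hc := condExp_ae_eq_integral_condDistrib hX h.measurable_logPrice.aemeasurable hf
      (h.integrable_cexp_logPrice u)
    filter_upwards [hc, h.condCharFun_ae_eq_condExp u] with ω h1 h2
    rw [charFun_plane, ← h1, h2]
  filter_upwards [hae, h.posSemidef_intCov] with ω h1 h2
  refine Measure.ext_of_charFun (Continuous.ext_on hDd continuous_charFun continuous_charFun ?_)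
  intro u hu
  rw [h1 u hu, charFun_multivariateGaussian h2, condCharFun, ← Complex.exp_add]
  congr 1
  simp only [condMean, PiLp.inner_apply, RCLike.inner_apply, conj_trivial, dotProduct,
    Matrix.mulVec, Fin.sum_univ_two]
  push_cast
  ring

/-- Since `i · (-½) · (-i) = -½`, the quadratic entries of `θ(u)` produce the Gaussian variance, and
the linear diagonal ones the drift correction `-½ diag Σ⁺_T`. Symmetry of `Σ⁺_T` plays no part. -/
theorem condCharFun_eq_expTrace (r : ℝ) (q : Plane) (T : ℝ≥0) (V : ℝ≥0 → Ω → Mat) (u : Plane)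
    (ω : Ω) : condCharFun r q T V u ω =
      Complex.exp (Complex.I * (∑ j, u j * (r - q j) : ℝ) * (T : ℝ)) *
        expTrace ((-(1 / 2) : ℂ) • thetaMat u) (intCov V T ω) := by
  rw [condCharFun, expTrace, ← Complex.exp_add, ← Complex.exp_add]
  congr 1
  simp only [condMean, thetaMat, Matrix.trace, Matrix.diag, Matrix.mul_apply, Fin.sum_univ_two,
    Matrix.smul_apply, Matrix.map_apply, Matrix.of_apply, Matrix.cons_val', Matrix.cons_val_zero,
    Matrix.cons_val_one, Matrix.cons_val_fin_one, smul_eq_mul]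
  push_cast
  linear_combination (-(1 / 2) * ((u 0 : ℂ) ^ 2 * intCov V T ω 0 0
    + u 0 * u 1 * (intCov V T ω 0 1 + intCov V T ω 1 0) + (u 1 : ℂ) ^ 2 * intCov V T ω 1 1))
    * Complex.I_sq

end IsPriceModel

theorem intCov_of_const {V : ℝ≥0 → Ω → Mat} {ω : Ω} {C : Mat} (h : ∀ t ≤ T, V t ω = C) :
    intCov V T ω = (T : ℝ) • C := by
  ext i k
  simp only [intCov, Matrix.of_apply, integral_zero_coe, Matrix.smul_apply]
  rw [setIntegral_congr_fun (g := fun _ => C i k) measurableSet_Ioc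
    fun s hs => by simp only [h _ (toNNReal_le_of_mem hs)]]
  simp

end StochCov

theorem lemma2p1 {Ω : Type*} {mΩ : MeasurableSpace Ω} (ℱ : Filtration ℝ≥0 mΩ)
    (Q : Measure Ω) [IsProbabilityMeasure Q] (r : ℝ) (q : StochCov.Plane) (T : ℝ≥0)
    (S Y B : ℝ≥0 → Ω → StochCov.Plane) (V H : ℝ≥0 → Ω → StochCov.Mat)
    (h : StochCov.IsPriceModel ℱ Q r q T S Y B V H) :
    -- conditionally on the covariance path, `Y_T` is normal with the stated mean and covariance
    (∀ᵐ ω ∂Q,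
      (∀ j k, IntervalIntegrable (fun t : ℝ => V t.toNNReal ω j k) volume 0 T) ∧
      (StochCov.intCov V T ω).PosSemidef ∧
      condDistrib (Y T) (StochCov.covPath V T) Q (StochCov.covPath V T ω) =
        multivariateGaussian
          (WithLp.toLp 2 fun j => (r - q j) * T - 1 / 2 * StochCov.intCov V T ω j j)
          (StochCov.intCov V T ω)) ∧
    -- the integrated covariance of a covariance process that is constant in time
    (∀ (ω : Ω) (C : StochCov.Mat), (∀ t ≤ T, V t ω = C) →
      StochCov.intCov V T ω = (T : ℝ) • C) ∧
    -- the characteristic function of `Y_T`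
    (∀ u : StochCov.Plane,
      Integrable (fun ω => StochCov.expTrace ((-(1 / 2) : ℂ) • StochCov.thetaMat u)
        (StochCov.intCov V T ω)) Q ∧
      charFun (Q.map (Y T)) u =
        Complex.exp (Complex.I * (∑ j, u j * (r - q j) : ℝ) * (T : ℝ)) *
          StochCov.matCharFun Q (StochCov.intCov V T)
            ((-(1 / 2) : ℂ) • StochCov.thetaMat u)) := by
  refine ⟨?_, fun ω C hC => StochCov.intCov_of_const hC, fun u => ?_⟩
  · filter_upwards [h.integrableOn_entry, h.posSemidef_intCov, h.condDistrib_logPrice]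
      with ω h1 h2 h3
    exact ⟨fun j k => (intervalIntegrable_iff_integrableOn_Ioc_of_le T.2).2 (h1 j k), h2, h3⟩
  have hne : Complex.exp (Complex.I * (∑ j, u j * (r - q j) : ℝ) * (T : ℝ)) ≠ 0 :=
    Complex.exp_ne_zero _
  have hcf := StochCov.IsPriceModel.condCharFun_eq_expTrace r q T V u
  constructor
  -- The trace exponential is the conditional characteristic function divided by a nonzero constant,
  -- hence integrable.
  · refine ((h.integrable_condCharFun u).const_mul
      (Complex.exp (Complex.I * (∑ j, u j * (r - q j) : ℝ) * (T : ℝ)))⁻¹).congr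
      (.of_forall fun ω => ?_)
    simp only [hcf]
    rw [inv_mul_cancel_left₀ hne]
  · rw [StochCov.charFun_plane, integral_map h.measurable_logPrice.aemeasurable
      (Continuous.aestronglyMeasurable (by fun_prop)), ← h.integral_condCharFun u,
      StochCov.matCharFun, ← integral_const_mul]
    simp only [hcf]
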